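/- **Setting.** Let $\mathbb N=\{1,2,\dots\}$, let $\mathbb S^1$ be the unit circle and $\mathbb U$ the closed complex unit disc. A completely multiplicative function $f\colon\mathbb N\to\mathbb S^1$ is an *MRT function* if there are strictly increasing sequences of integers $(t_m)_{m\ge1}$, $(s_m)_{m\ge 1}$ with $t_1=1$ such that for every $m\in\mathbb N$: (i) $t_m<s_{m+1}<s_{m+1}^2\le t_{m+1}$; (ii) $f(p)=p^{is_{m+1}}$ for every prime $p\in(t_m,t_{m+1}]$; (iii) $|f(p)-p^{is_{m+1}}|\le 1/t_m^2$ for every prime $p\le t_m$. For real $M\ge1$ let $[M]=\{1,\dots,\lfloor M\rfloor\}$ and $\mathbb E^{\log}_{n\in[M]}u(n)=\big(\sum_{n\in[M]}\tfrac1n\big)^{-1}\sum_{n\in[M]}\tfrac{u(n)}n$. A sequence of positive reals $L_N\to+\infty$ has *fractional degree* $\delta$ if $\lim_{N\to\infty}\log L_N/\log N=\delta$ (for example $L_N=N^{\delta}$, $\delta>0$). Let $X=\mathbb U^{\mathbb Z}$ with the product topology, let $(Tx)(k)=x(k+1)$ be the shift on $X$, and $F_0(x)=x(0)$. Given $f\colon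 \mathbb N\to\mathbb S^1$, extended arbitrarily to a point $f\in X$, and reals $N_m\to\infty$, the *Furstenberg system of $f$ for logarithmic averages along $([N_m])$* is $(X,\mu,T)$ where $\mu$ is the weak-star limit $\lim_{m\to\infty}\mathbb E^{\log}_{n\in[N_m]}\delta_{T^nf}$, if this limit exists. The *spectrum* of a system $(X,\mu,T)$ is the set of $\alpha\in[0,1)$ for which $g\circ T=e^{2\pi i\alpha}g$ $\mu$-a.e. for some non-zero $g\in L^2(\mu)$; it is *trivial* if it equals $\{0\}$. The system $(X,\mu,T)$ is *strongly stationary* if $\int\prod_{j=1}^{\ell}F_j(T^{n_j}x)\,d\mu=\int\prod_{j=1}^{\ell}F_j(T^{rn_j}x)\,d\mu$ for all $\ell,r\in\mathbb N$, $n_1,\dots,n_\ell\in\mathbb Z$, $F_1,\dots,F_\ell\in\{F_0,\overline{F_0}\}$. Systems $(X,\mu,T)$ and $(Y,\nu,S)$ are *isomorphic* if there is a measurable $\Phi\colon X\to Y$ with $\Phi_*\mu=\nu$ and $S\circ\Phi=\Phi\circ T$ $\mu$-a.e. that is injective on a $T$-invariant set of full $\mu$-measure. For an integer $d\ge 0$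 let $Y_d=\mathbb T^{d+1}$ with $\mathbb T=\mathbb R/\mathbb Z$, let $\nu_d$ be Haar probability measure on $Y_d$, and let $S_d(x_0,\dots,x_d)=(x_0,x_1+x_0,\dots,x_d+x_{d-1})$ (the *level $d$ unipotent system*). For $c>0$ let $Z_c$ be the disjoint union of the $Y_d$, $d\ge\lfloor c\rfloor$, let $R_c$ be the transformation of $Z_c$ that equals $S_d$ on $Y_d$, and let $$\nu'_c=\Big(1-\frac c{\lceil c\rceil}\Big)\nu_{\lfloor c\rfloor}+c\sum_{d=\lceil c\rceil}^\infty\Big(\frac1d-\frac1{d+1}\Big)\nu_d .$$ **Theorem.** Let $f\colon\mathbb N\to\mathbb S^1$ be an MRT function with associated sequences $(t_m)$, $(s_m)$, let $c>0$, and let $(L_N)$ be a sequence of positive reals of fractional degree $1/c$ (for example $L_N=N^{1/c}$). If $c<1/2$, assume moreover that $L_{s_{m+1}}\le t_{m+1}$ for all sufficiently large $m$. Then the Furstenberg system $(X,\mu_c,T)$ of $f$ for logarithmic averages along $([L_{s_{m+1}}])_{m}$ exists (that is, the limit defining $\mu_c$ exists and is a $T$-invariant probability measure), it has trivial spectrum,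 it is strongly stationary, and it is isomorphic to the system $(Z_c,\nu'_c,R_c)$. -/

import Mathlib

open MeasureTheory Filter Topology

noncomputable section

/-! ### Systems, isomorphism and spectrum -/

/-- Two systems `(X, μ, T)` and `(Y, ν, S)` are isomorphic: there is a measurable map
`Φ : X → Y` with `Φ_* μ = ν` and `S ∘ Φ = Φ ∘ T` almost everywhere, which is injective on a
`T`-invariant set of full measure. (All systems below live on standard Borel spaces.) -/
def SystemsIsomorphic {X Y : Type*} [MeasurableSpace X] [MeasurableSpace Y]
    (μ : Measure X) (T : X → X) (ν : Measure Y) (S : Y → Y) : Prop :=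
  ∃ Φ : X → Y, Measurable Φ ∧ μ.map Φ = ν ∧ (∀ᵐ x ∂μ, S (Φ x) = Φ (T x)) ∧
    ∃ A : Set X, MeasurableSet A ∧ T ⁻¹' A = A ∧ μ Aᶜ = 0 ∧ Set.InjOn Φ A

/-- The spectrum of `(X, μ, T)`: the set of `α ∈ [0, 1)` for which there is a non-zero
`g ∈ L²(μ)` with `g ∘ T = e(α) g`, where `e(α) = exp (2 π i α)`. -/
def systemSpectrum {X : Type*} [MeasurableSpace X] (μ : Measure X) (T : X → X) : Set ℝ :=
  {α | α ∈ Set.Ico (0 : ℝ) 1 ∧ ∃ g : X → ℂ, MemLp g 2 μ ∧ ¬ (g =ᵐ[μ] 0) ∧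
    ∀ᵐ x ∂μ, g (T x) = Complex.exp (2 * Real.pi * Complex.I * α) * g x}

/-! ### The sequence space and Furstenberg systems for logarithmic averages -/

/-- The closed complex unit disc. -/
abbrev ClosedDisc : Type := Metric.closedBall (0 : ℂ) 1

/-- The space of two-sided sequences in the closed unit disc, with the product topology and
the product (equivalently, Borel) σ-algebra. -/
abbrev SeqSpace : Type := ℤ → ClosedDisc

/-- The `n`-th power `T^n` (for `n ∈ ℤ`) of the shift `T`. -/
def shiftPow (n : ℤ) (x : SeqSpace) : SeqSpace := fun k => x (k + n)

/-- The shift `(T x)(k) = x(k + 1)`. -/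
def shift : SeqSpace → SeqSpace := shiftPow 1

/-- The `0`-th coordinate projection `F₀`. -/
def coordZero (x : SeqSpace) : ℂ := (x 0 : ℂ)

/-- The logarithmic average of `u` over `[M] = {1, …, ⌊M⌋}`. -/
def logAverage (M : ℝ) (u : ℕ → ℂ) : ℂ :=
  (∑ n ∈ Finset.Icc 1 ⌊M⌋₊, u n / (n : ℂ)) / ∑ n ∈ Finset.Icc 1 ⌊M⌋₊, 1 / (n : ℂ)

/-- `(SeqSpace, μ, shift)` is the Furstenberg system of the sequence `a` for logarithmic averages
along the intervals `[M m]`: `μ` is the weak-star limit of the logarithmic averages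
over `n ∈ [M m]` of the point masses at `T^n a`. -/
structure IsLogFurstenbergMeasure (a : SeqSpace) (M : ℕ → ℝ) (μ : Measure SeqSpace) : Prop where
  isProbabilityMeasure : IsProbabilityMeasure μ
  tendsto_logAverage : ∀ F : C(SeqSpace, ℂ),
    Tendsto (fun m => logAverage (M m) fun n => F (shiftPow n a)) atTop (𝓝 (∫ x, F x ∂μ))

/-- Strong stationarity of the sequence space system `(SeqSpace, μ, shift)`. -/
def StronglyStationary (μ : Measure SeqSpace) : Prop :=
  ∀ (ℓ r : ℕ), 0 < r → ∀ (n : Fin ℓ → ℤ) (F : Fin ℓ → SeqSpace → ℂ),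
    (∀ j, F j = coordZero ∨ F j = fun x => starRingEnd ℂ (coordZero x)) →
    ∫ x, ∏ j, F j (shiftPow (n j) x) ∂μ = ∫ x, ∏ j, F j (shiftPow (r * n j) x) ∂μ

/-! ### The MRT class and fractional degree -/

/-- The completely multiplicative function `f : ℕ+ → 𝕊¹` is an MRT function, with defining
sequences `t`, `s`. Indices start at `0` here, so that `t 0 = 1` is the normalisation of
the first term. The integers `t m` and `s (m + 1)` are automatically positive, and the value of the
first term `s 0` is irrelevant, so the sequences are taken in `ℕ`. -/
structure IsMRTFunction (f : ℕ+ →* Circle) (t s : ℕ → ℕ) : Prop where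
  strictMono_t : StrictMono t
  strictMono_s : StrictMono s
  t_zero : t 0 = 1
  growth : ∀ m, t m < s (m + 1) ∧ s (m + 1) < s (m + 1) ^ 2 ∧ s (m + 1) ^ 2 ≤ t (m + 1)
  eq_on_interval : ∀ m, ∀ p : ℕ+, (p : ℕ).Prime → t m < p → (p : ℕ) ≤ t (m + 1) →
    (f p : ℂ) = ((p : ℕ) : ℂ) ^ (Complex.I * (s (m + 1) : ℂ))
  approx_below : ∀ m, ∀ p : ℕ+, (p : ℕ).Prime → (p : ℕ) ≤ t m →
    ‖(f p : ℂ) - ((p : ℕ) : ℂ) ^ (Complex.I * (s (m + 1) : ℂ))‖ ≤ 1 / (t m : ℝ) ^ 2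

/-- The sequence `(L N)`, `N = 1, 2, …`, of positive reals tends to infinity and has fractional
degree `δ`. -/
def HasFractionalDegree (L : ℕ → ℝ) (δ : ℝ) : Prop :=
  (∀ N, 1 ≤ N → 0 < L N) ∧ Tendsto L atTop atTop ∧
    Tendsto (fun N : ℕ => Real.log (L N) / Real.log N) atTop (𝓝 δ)

/-- The basic example: `(N ^ δ)` has fractional degree `δ`. -/
theorem hasFractionalDegree_rpow {δ : ℝ} (hδ : 0 < δ) :
    HasFractionalDegree (fun N : ℕ => (N : ℝ) ^ δ) δ := by
  refine ⟨fun N hN => Real.rpow_pos_of_pos (by exact_mod_cast hN) δ,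
    (tendsto_rpow_atTop hδ).comp tendsto_natCast_atTop_atTop, ?_⟩
  refine tendsto_const_nhds.congr' ?_
  filter_upwards [eventually_ge_atTop 2] with N hN
  have h1 : (1 : ℝ) < N := by exact_mod_cast hN
  rw [Real.log_rpow (by linarith), mul_div_assoc, div_self (Real.log_pos h1).ne', mul_one]

/-! ### Unipotent systems and their mixture -/

/-- The transformation `(x₀, …, x_d) ↦ (x₀, x₁ + x₀, …, x_d + x_{d-1})` of the level `d` unipotent
system on `𝕋^{d+1}` (whose measure is `volume`, the Haar probability measure). -/
def unipotentMap (d : ℕ) (x : Fin (d + 1) → UnitAddCircle) : Fin (d + 1) → UnitAddCircle :=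
  Fin.cases (x 0) fun j => x j.succ + x j.castSucc

/-- The space `Z_c`: the disjoint union of the tori `𝕋^{d+1}` over `d ≥ ⌊c⌋`. -/
abbrev MixtureSpace (c : ℝ) : Type :=
  Σ d : {d : ℕ // ⌊c⌋₊ ≤ d}, (Fin (d.1 + 1) → UnitAddCircle)

/-- The transformation `R_c` of `Z_c`, equal to the unipotent map on every piece. -/
def mixtureMap (c : ℝ) (z : MixtureSpace c) : MixtureSpace c :=
  ⟨z.1, unipotentMap z.1.1 z.2⟩

/-- Haar measure on the piece of level `d`, seen as a measure on `Z_c`. -/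
def levelMeasure (c : ℝ) (d : {d : ℕ // ⌊c⌋₊ ≤ d}) : Measure (MixtureSpace c) :=
  (volume : Measure (Fin (d.1 + 1) → UnitAddCircle)).map fun x => ⟨d, x⟩

/-- The measure
`(1 - c / ⌈c⌉) ν_{⌊c⌋} + c ∑_{d ≥ ⌈c⌉} (1 / d - 1 / (d + 1)) ν_d` on `Z_c`. -/
def mixtureMeasure (c : ℝ) : Measure (MixtureSpace c) :=
  ENNReal.ofReal (1 - c / ⌈c⌉₊) • levelMeasure c ⟨⌊c⌋₊, le_rfl⟩ +
    ENNReal.ofReal c • Measure.sum fun d : {d : ℕ // ⌈c⌉₊ ≤ d} =>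
      ENNReal.ofReal (1 / (d.1 : ℝ) - 1 / ((d.1 : ℝ) + 1)) •
        levelMeasure c ⟨d.1, (Nat.floor_le_ceil c).trans d.2⟩

end

/-! By Stone–Weierstrass a measure on the sequence space is determined by its integrals of monomials
in the coordinates and their conjugates. A monomial is encoded by a list `l` of signed shifts `(h,
ε)`, and every integral that occurs depends only on the order of `l`: the least `k` with `moment k l
≠ 0`, if there is one.

Arithmetic side. Up to `t (m + 1)`, the function `f` is close in logarithmic average to `n ^ (i s)`
with `s = s (m + 1)`, so the monomial along the orbit may be replaced by `exp (i s ∑ ε log (n +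
h))`. For order `k ≥ 1` the phase is asymptotic to a constant times `s / n ^ k`. Beyond `n = s ^ (1
/ k)` the twist is essentially `1`; before that point it oscillates and its logarithmic sum is
`o(log s)`. Up to `s ^ (1 / c)` the sum is therefore about `max 0 (1 / c - 1 / k) * log s`, and
dividing by `log s / c` gives the correlation `max 0 (1 - c / k)`. Order `0` gives `0`, and
vanishing of all moments gives `1` (`SignedShifts.tendsto_sum_twist`,
`IsMRTFunction.tendsto_logAverage_coordMonomial`). The oscillation is seen by summation by parts for
`n` between `s ^ (1 / (k + 1))` and `s ^ (1 / k)`. For smaller `n`, van der Corput differencing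
raises the order by one, and one descends through the scales.

Model side. The last coordinate of a level `d` unipotent orbit is a polynomial sequence with Haar
random coefficients, so a monomial integrates to `1` or `0` according to whether all moments up to
`d` vanish. The weights telescope and the mixture has the same correlations
(`integral_coordMonomial_mixturePoint`). Hence the limit measure is the image of the mixture under
`mixturePoint`, a map which is injective off the null set of vanishing leading coefficients
(`systemsIsomorphic_map_mixturePoint`).

Invariance and strong stationarity hold because translating or dilating the shifts preserves the
order. For the spectrum, distinct translates of a monomial all have the same inner product, which
leaves no room for an eigenvalue other than `1` (`systemSpectrum_eq_zero`). -/

/-! ### Signed shifts, their moments and their phases -/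

/-- A list of shifts `h`, each with a sign `ε`; it encodes the product of the `n ↦ u (n + h) ^ ε`. -/
abbrev SignedShifts : Type := List (ℤ × ℤˣ)

namespace SignedShifts

/-- The moment `∑ ε h ^ i`. -/
def moment (i : ℕ) (l : SignedShifts) : ℤ := (l.map fun q => (q.2 : ℤ) * q.1 ^ i).sum

/-- The function `x ↦ ∑ ε log (x + h)`. -/
noncomputable def logPhase (l : SignedShifts) (x : ℝ) : ℝ :=
  (l.map fun q => ((q.2 : ℤ) : ℝ) * Real.log (x + q.1)).sum

/-- The unimodular sequence `n ↦ ∏ (n + h) ^ (i ε s)`. -/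
noncomputable def twist (l : SignedShifts) (s n : ℕ) : ℂ :=
  Complex.exp (Complex.I * ((s * logPhase l n : ℝ) : ℂ))

/-- Translate all shifts by `h`. -/
def translate (h : ℤ) (l : SignedShifts) : SignedShifts := l.map fun q => (q.1 + h, q.2)

/-- Change all signs. -/
def opposite (l : SignedShifts) : SignedShifts := l.map fun q => (q.1, -q.2)

@[simp] lemma moment_nil (i : ℕ) : moment i [] = 0 := rfl

@[simp] lemma moment_cons (i : ℕ) (q : ℤ × ℤˣ) (l : SignedShifts) :
    moment i (q :: l) = (q.2 : ℤ) * q.1 ^ i + moment i l := by simp [moment]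

@[simp] lemma moment_append (i : ℕ) (l l' : SignedShifts) :
    moment i (l ++ l') = moment i l + moment i l' := by simp [moment]

@[simp] lemma moment_opposite (i : ℕ) (l : SignedShifts) :
    moment i (opposite l) = -moment i l := by
  induction l with
  | nil => rfl
  | cons q l ih =>
    have : opposite (q :: l) = (q.1, -q.2) :: opposite l := rfl
    rw [this, moment_cons, ih, moment_cons]; push_cast; ring

lemma moment_translate (i : ℕ) (h : ℤ) (l : SignedShifts) :
    moment i (translate h l) =
      ∑ j ∈ Finset.range (i + 1), (i.choose j : ℤ) * h ^ (i - j) * moment j l := by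
  induction l with
  | nil => simp [translate]
  | cons q l ih =>
    have : translate h (q :: l) = (q.1 + h, q.2) :: translate h l := rfl
    simp only [this, moment_cons, ih, mul_add, Finset.sum_add_distrib, add_pow, Finset.mul_sum]
    congr 1
    exact Finset.sum_congr rfl fun j _ => by ring

/-- The binomial formula changes a moment only by multiples of lower ones, so the order and the
leading moment are translation invariant. -/
lemma moment_translate_eq {k : ℕ} {l : SignedShifts} (hl : ∀ i < k, moment i l = 0) (h : ℤ) :
    ∀ i ≤ k, moment i (translate h l) = moment i l := by
  intro i hi
  rw [moment_translate, Finset.sum_range_succ, Finset.sum_eq_zero, zero_add]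
  · simp
  · intro j hj
    rw [hl j (by have := Finset.mem_range.1 hj; omega), mul_zero]

/-- One step past the order the dependence on `h` is linear with slope `(k + 1) * moment k l`. Hence
the difference of two distinct translates of a list of order `k` has order exactly `k + 1`; this
drives the differencing, the phase increments and the spectral argument. -/
lemma moment_succ_translate {k : ℕ} {l : SignedShifts} (hl : ∀ i < k, moment i l = 0) (h : ℤ) :
    moment (k + 1) (translate h l) = (k + 1) * h * moment k l + moment (k + 1) l := by
  rw [moment_translate, Finset.sum_range_succ, Finset.sum_range_succ, Finset.sum_eq_zero, zero_add]
  · simp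
  · intro j hj
    rw [hl j (by simpa using hj), mul_zero]

@[simp] lemma logPhase_append (l l' : SignedShifts) (x : ℝ) :
    logPhase (l ++ l') x = logPhase l x + logPhase l' x := by simp [logPhase]

@[simp] lemma logPhase_cons (q : ℤ × ℤˣ) (l : SignedShifts) (x : ℝ) :
    logPhase (q :: l) x = ((q.2 : ℤ) : ℝ) * Real.log (x + q.1) + logPhase l x := by simp [logPhase]

@[simp] lemma logPhase_opposite (l : SignedShifts) (x : ℝ) :
    logPhase (opposite l) x = -logPhase l x := by
  induction l with
  | nil => simp [opposite, logPhase]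
  | cons q l ih =>
    have : opposite (q :: l) = (q.1, -q.2) :: opposite l := rfl
    rw [this, logPhase_cons, ih, logPhase_cons]; push_cast; ring

@[simp] lemma logPhase_translate (h : ℤ) (l : SignedShifts) (x : ℝ) :
    logPhase (translate h l) x = logPhase l (x + h) := by
  induction l with
  | nil => simp [translate, logPhase]
  | cons q l ih =>
    have : translate h (q :: l) = (q.1 + h, q.2) :: translate h l := rfl
    rw [this, logPhase_cons, ih, logPhase_cons]; push_cast; ring_nf

@[simp] lemma norm_twist (l : SignedShifts) (s n : ℕ) : ‖twist l s n‖ = 1 := by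
  rw [twist, mul_comm, Complex.norm_exp_ofReal_mul_I]

/-- The products met in van der Corput differencing are again twists, so an induction over lists is
possible. -/
lemma twist_mul_conj (l : SignedShifts) (s n h h' : ℕ) :
    twist l s (n + h) * starRingEnd ℂ (twist l s (n + h')) =
      twist (translate h l ++ opposite (translate h' l)) s n := by
  rw [twist, twist, twist, ← Complex.exp_conj, ← Complex.exp_add]
  congr 1
  simp only [map_mul, Complex.conj_I, Complex.conj_ofReal, logPhase_append, logPhase_opposite,
    logPhase_translate]
  push_cast
  ring

/-- Taylor expansion of `log (1 - x)` at `x = -h / n`; since `|x| < 1 / 2`, the factor `1 / (1 -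
|x|)` in the remainder is at most `2`. -/
lemma abs_log_natCast_add_intCast_sub_le (h : ℤ) (k n : ℕ) (hn : 2 * |h| < n) :
    |Real.log (n + h) - Real.log n +
      ∑ i ∈ Finset.range k, (-1 : ℝ) ^ (i + 1) * h ^ (i + 1) / ((i + 1) * n ^ (i + 1))| ≤
      2 * |(h : ℝ)| ^ (k + 1) / n ^ (k + 1) := by
  have hn' : 2 * |(h : ℝ)| < n := by exact_mod_cast hn
  have hn0 : (0 : ℝ) < n := by linarith [abs_nonneg (h : ℝ)]
  have hx : |(-h / n : ℝ)| < 1 / 2 := by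
    rw [abs_div, abs_neg, abs_of_pos hn0, div_lt_iff₀ hn0]; linarith
  have key := Real.abs_log_sub_add_sum_range_le (x := (-h / n : ℝ)) (by linarith) k
  have h1 : Real.log (1 - (-h / n : ℝ)) = Real.log (n + h) - Real.log n := by
    rw [← Real.log_div _ hn0.ne']
    · congr 1; field_simp; ring
    · have := neg_abs_le (h : ℝ)
      have := abs_nonneg (h : ℝ)
      intro h0; linarith
  rw [h1, add_comm] at key
  have h2 : ∀ i ∈ Finset.range k, (-h / n : ℝ) ^ (i + 1) / (i + 1) =
      (-1 : ℝ) ^ (i + 1) * h ^ (i + 1) / ((i + 1) * n ^ (i + 1)) := by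
    intro i _
    rw [div_pow, neg_pow, div_div, mul_comm ((n : ℝ) ^ (i + 1))]
  rw [Finset.sum_congr rfl h2] at key
  refine key.trans ?_
  have h3 : |(-h / n : ℝ)| ^ (k + 1) = |(h : ℝ)| ^ (k + 1) / n ^ (k + 1) := by
    rw [abs_div, abs_neg, abs_of_pos hn0, div_pow]
  rw [h3, mul_div_assoc, div_le_iff₀ (by linarith)]
  have : 0 ≤ |(h : ℝ)| ^ (k + 1) / n ^ (k + 1) := by positivity
  nlinarith

/-- Adding the Taylor expansions of `log (n + h)` over the list turns the coefficients of `1 / n ^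
i` into moments, so vanishing moments mean decay of the phase. -/
lemma exists_abs_logPhase_expansion (l : SignedShifts) (k : ℕ) :
    ∃ B : ℝ, 0 ≤ B ∧ ∃ n₀ : ℕ, 0 < n₀ ∧ ∀ n : ℕ, n₀ ≤ n →
      |logPhase l n - moment 0 l * Real.log n +
        ∑ i ∈ Finset.range k, (-1 : ℝ) ^ (i + 1) * moment (i + 1) l / ((i + 1) * n ^ (i + 1))| ≤
        B / n ^ (k + 1) := by
  induction l with
  | nil => exact ⟨0, le_rfl, 1, one_pos, fun n _ => by simp [logPhase]⟩
  | cons q l ih =>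
    obtain ⟨B, hB, n₀, hn₀, H⟩ := ih
    refine ⟨2 * |(q.1 : ℝ)| ^ (k + 1) + B, by positivity, n₀ + 2 * q.1.natAbs, by omega,
      fun n hn => ?_⟩
    have h1 := abs_log_natCast_add_intCast_sub_le q.1 k n (by rw [Int.abs_eq_natAbs]; omega)
    have h2 := H n (by omega)
    have hq : |((q.2 : ℤ) : ℝ)| = 1 := by
      rcases Int.units_eq_one_or q.2 with h | h <;> simp [h]
    have h3 : logPhase (q :: l) n - moment 0 (q :: l) * Real.log n +
        ∑ i ∈ Finset.range k, (-1 : ℝ) ^ (i + 1) * moment (i + 1) (q :: l) /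
          ((i + 1) * n ^ (i + 1)) =
        ((q.2 : ℤ) : ℝ) * (Real.log (n + q.1) - Real.log n +
          ∑ i ∈ Finset.range k, (-1 : ℝ) ^ (i + 1) * q.1 ^ (i + 1) / ((i + 1) * n ^ (i + 1))) +
        (logPhase l n - moment 0 l * Real.log n +
          ∑ i ∈ Finset.range k, (-1 : ℝ) ^ (i + 1) * moment (i + 1) l /
            ((i + 1) * n ^ (i + 1))) := by
      have : ∑ i ∈ Finset.range k, (-1 : ℝ) ^ (i + 1) * moment (i + 1) (q :: l) /
          ((i + 1) * n ^ (i + 1)) = ((q.2 : ℤ) : ℝ) * ∑ i ∈ Finset.range k,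
            (-1 : ℝ) ^ (i + 1) * q.1 ^ (i + 1) / ((i + 1) * n ^ (i + 1)) +
          ∑ i ∈ Finset.range k, (-1 : ℝ) ^ (i + 1) * moment (i + 1) l /
            ((i + 1) * n ^ (i + 1)) := by
        rw [Finset.mul_sum, ← Finset.sum_add_distrib]
        refine Finset.sum_congr rfl fun i _ => ?_
        rw [moment_cons]; push_cast; ring
      rw [this, logPhase_cons, moment_cons]; push_cast; ring
    rw [h3]
    refine (abs_add_le _ _).trans ?_
    rw [abs_mul, hq, one_mul, add_div]
    exact add_le_add h1 h2

lemma exists_abs_logPhase_le {l : SignedShifts} {k : ℕ} (hl : ∀ i ≤ k, moment i l = 0) :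
    ∃ B : ℝ, 0 ≤ B ∧ ∃ n₀ : ℕ, 0 < n₀ ∧ ∀ n : ℕ, n₀ ≤ n →
      |logPhase l n + (-1 : ℝ) ^ (k + 1) * moment (k + 1) l / ((k + 1) * n ^ (k + 1))| ≤
        B / n ^ (k + 2) := by
  obtain ⟨B, hB, n₀, hn₀, H⟩ := exists_abs_logPhase_expansion l (k + 1)
  refine ⟨B, hB, n₀, hn₀, fun n hn => ?_⟩
  have := H n hn
  rwa [hl 0 (Nat.zero_le _), Finset.sum_range_succ, Finset.sum_eq_zero, Int.cast_zero, zero_mul,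
    sub_zero, zero_add] at this
  intro i hi
  rw [hl (i + 1) (Finset.mem_range.1 hi), Int.cast_zero, mul_zero, zero_div]

lemma exists_norm_twist_sub_one_le {l : SignedShifts} {k : ℕ} (hl : ∀ i < k, moment i l = 0)
    (hk : 0 < k) :
    ∃ B : ℝ, 0 ≤ B ∧ ∃ n₀ : ℕ, 0 < n₀ ∧ ∀ s n : ℕ, n₀ ≤ n →
      ‖twist l s n - 1‖ ≤ B * s / n ^ k := by
  obtain ⟨k, rfl⟩ := Nat.exists_eq_add_of_lt hk
  rw [zero_add] at *
  obtain ⟨B, hB, n₀, hn₀, H⟩ := exists_abs_logPhase_expansion l k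
  refine ⟨B, hB, n₀, hn₀, fun s n hn => ?_⟩
  have h1 := H n hn
  rw [hl 0 (by omega), Finset.sum_eq_zero, Int.cast_zero, zero_mul, sub_zero, add_zero] at h1
  · refine Real.norm_exp_I_mul_ofReal_sub_one_le.trans ?_
    rw [norm_mul, Real.norm_natCast, Real.norm_eq_abs, mul_comm B, mul_div_assoc]
    gcongr
  · intro i hi
    rw [hl (i + 1) (by have := Finset.mem_range.1 hi; omega), Int.cast_zero, mul_zero, zero_div]

/-- The increment is the phase of `translate 1 l ++ opposite l`, whose moment of order `k + 1` is
`(k + 1) * moment k l`; the factor `k + 1` cancels against the Taylor coefficient. -/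
lemma exists_abs_logPhase_succ_sub_le {l : SignedShifts} {k : ℕ} (hl : ∀ i < k, moment i l = 0) :
    ∃ B : ℝ, 0 ≤ B ∧ ∃ n₀ : ℕ, 0 < n₀ ∧ ∀ n : ℕ, n₀ ≤ n →
      |logPhase l (n + 1 : ℕ) - logPhase l n - (-1 : ℝ) ^ k * moment k l / n ^ (k + 1)| ≤
        B / n ^ (k + 2) := by
  have hD : ∀ i ≤ k, moment i (translate 1 l ++ opposite l) = 0 := fun i hi => by
    rw [moment_append, moment_opposite, moment_translate_eq hl 1 i hi]; ring
  have hD' : moment (k + 1) (translate 1 l ++ opposite l) = (k + 1) * moment k l := by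
    rw [moment_append, moment_opposite, moment_succ_translate hl]; ring
  obtain ⟨B, hB, n₀, hn₀, H⟩ := exists_abs_logPhase_le hD
  refine ⟨B, hB, n₀, hn₀, fun n hn => ?_⟩
  convert H n hn using 2
  rw [hD', logPhase_append, logPhase_opposite, logPhase_translate]
  have : (k + 1 : ℝ) ≠ 0 := by positivity
  have hn' : (n : ℝ) ≠ 0 := by exact_mod_cast (by omega : n ≠ 0)
  push_cast
  field_simp
  ring

end SignedShifts

/-! ### Sums over intervals with weights `1 / n` -/

lemma sum_Ico_mul_sub_eq (w : ℕ → ℝ) (E : ℕ → ℂ) {a b : ℕ} (hab : a ≤ b) :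
    ∑ n ∈ Finset.Ico a b, (w n : ℂ) * (E (n + 1) - E n) =
      w b * E b - w a * E a - ∑ n ∈ Finset.Ico a b, ((w (n + 1) - w n : ℝ) : ℂ) * E (n + 1) := by
  induction b, hab using Nat.le_induction with
  | base => simp
  | succ b hb ih =>
    rw [Finset.sum_Ico_succ_top hb, Finset.sum_Ico_succ_top hb, ih]
    push_cast
    ring

lemma norm_sum_Ico_mul_sub_le (w : ℕ → ℝ) (E : ℕ → ℂ) {a b : ℕ} (hab : a ≤ b) {D : ℝ}
    (hE : ∀ n, ‖E n‖ ≤ D) :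
    ‖∑ n ∈ Finset.Ico a b, (w n : ℂ) * (E (n + 1) - E n)‖ ≤
      D * (|w b| + |w a| + ∑ n ∈ Finset.Ico a b, |w (n + 1) - w n|) := by
  rw [sum_Ico_mul_sub_eq w E hab]
  refine (norm_sub_le _ _).trans ?_
  have hwn : ∀ (x : ℝ) n, ‖(x : ℂ) * E n‖ ≤ D * |x| := fun x n => by
    rw [norm_mul, Complex.norm_real, Real.norm_eq_abs, mul_comm]
    gcongr
    exact hE n
  have h1 : ‖(w b : ℂ) * E b - w a * E a‖ ≤ D * |w b| + D * |w a| :=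
    (norm_sub_le _ _).trans (add_le_add (hwn _ _) (hwn _ _))
  have h2 : ‖∑ n ∈ Finset.Ico a b, ((w (n + 1) - w n : ℝ) : ℂ) * E (n + 1)‖ ≤
      D * ∑ n ∈ Finset.Ico a b, |w (n + 1) - w n| := by
    rw [Finset.mul_sum]
    exact (norm_sum_le _ _).trans (Finset.sum_le_sum fun n _ => hwn _ _)
  linarith

lemma sum_Ico_abs_sub_of_monotone {w : ℕ → ℝ} {a b : ℕ} (hab : a ≤ b)
    (hw : ∀ n ∈ Finset.Ico a b, w n ≤ w (n + 1)) :
    ∑ n ∈ Finset.Ico a b, |w (n + 1) - w n| = w b - w a := by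
  rw [Finset.sum_congr rfl fun n hn => abs_of_nonneg (sub_nonneg.2 (hw n hn)),
    Finset.sum_Ico_sub w hab]

lemma sum_Ico_abs_sub_of_antitone {w : ℕ → ℝ} {a b : ℕ} (hab : a ≤ b)
    (hw : ∀ n ∈ Finset.Ico a b, w (n + 1) ≤ w n) :
    ∑ n ∈ Finset.Ico a b, |w (n + 1) - w n| = w a - w b := by
  rw [Finset.sum_congr rfl fun n hn => abs_of_nonpos (sub_nonpos.2 (hw n hn)),
    Finset.sum_neg_distrib, Finset.sum_Ico_sub w hab, neg_sub]

/-- Shifting a bounded sequence changes its logarithmic sums boundedly. -/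
lemma norm_sum_Ico_succ_div_sub_le (E : ℕ → ℂ) {D : ℝ} (hE : ∀ n, ‖E n‖ ≤ D) {a b : ℕ}
    (ha : 1 ≤ a) (hab : a ≤ b) :
    ‖∑ n ∈ Finset.Ico a b, E (n + 1) / n - ∑ n ∈ Finset.Ico a b, E n / n‖ ≤ 2 * D := by
  have hD : 0 ≤ D := (norm_nonneg _).trans (hE 0)
  have h := norm_sum_Ico_mul_sub_le (fun n => 1 / n) E hab hE
  have hw : ∀ n ∈ Finset.Ico a b, (1 / ((n + 1 : ℕ) : ℝ)) ≤ 1 / (n : ℝ) := fun n hn => by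
    have : 0 < n := ha.trans (Finset.mem_Ico.1 hn).1
    have : (0 : ℝ) < n := by exact_mod_cast this
    gcongr; simp
  rw [sum_Ico_abs_sub_of_antitone (w := fun n => 1 / (n : ℝ)) hab hw] at h
  have ha' : (1 : ℝ) ≤ a := by exact_mod_cast ha
  have hb' : (1 : ℝ) ≤ b := by exact_mod_cast ha.trans hab
  rw [abs_of_pos (by positivity), abs_of_pos (by positivity)] at h
  have h1 : (1 : ℝ) / a ≤ 1 := by rw [div_le_one (by linarith)]; exact ha'
  have h2 : ∑ n ∈ Finset.Ico a b, E (n + 1) / n - ∑ n ∈ Finset.Ico a b, E n / n =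
      ∑ n ∈ Finset.Ico a b, ((1 / n : ℝ) : ℂ) * (E (n + 1) - E n) := by
    rw [← Finset.sum_sub_distrib]
    refine Finset.sum_congr rfl fun n _ => ?_
    push_cast; ring
  rw [h2]
  refine h.trans ?_
  nlinarith

lemma norm_sum_Ico_add_div_sub_le (E : ℕ → ℂ) {D : ℝ} (hE : ∀ n, ‖E n‖ ≤ D) {a b : ℕ}
    (ha : 1 ≤ a) (hab : a ≤ b) (h : ℕ) :
    ‖∑ n ∈ Finset.Ico a b, E (n + h) / n - ∑ n ∈ Finset.Ico a b, E n / n‖ ≤ 2 * D * h := by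
  induction h with
  | zero => simp
  | succ h ih =>
    have := norm_sum_Ico_succ_div_sub_le (fun n => E (n + h)) (fun n => hE _) ha hab
    have e : ∀ n, n + 1 + h = n + (h + 1) := fun n => by ring
    simp only [e] at this
    push_cast
    calc _ ≤ _ := norm_sub_le_norm_sub_add_norm_sub _ (∑ n ∈ Finset.Ico a b, E (n + h) / n) _
      _ ≤ 2 * D * (h + 1) := by linarith

/-- Telescoping comparison `1 / n ^ 2 ≤ 1 / (n - 1 / 2) - 1 / (n + 1 / 2)`. This is the form in
which every error term becomes bounded uniformly in the interval. -/
lemma sum_Ico_div_sq_le {a b : ℕ} (ha : 1 ≤ a) (hab : a ≤ b) :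
    ∑ n ∈ Finset.Ico a b, (a : ℝ) / n ^ 2 ≤ 2 := by
  have ha' : (1 : ℝ) ≤ a := by exact_mod_cast ha
  have key : ∑ n ∈ Finset.Ico a b, (a : ℝ) / n ^ 2 ≤ a * (1 / (a - 1 / 2) - 1 / (b - 1 / 2)) := by
    induction b, hab using Nat.le_induction with
    | base => simp
    | succ b hb ih =>
      rw [Finset.sum_Ico_succ_top hb]
      have hb' : (1 : ℝ) ≤ b := by exact_mod_cast ha.trans hb
      have : (1 : ℝ) / b ^ 2 ≤ 1 / (b - 1 / 2) - 1 / ((b + 1 : ℕ) - 1 / 2) := by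
        push_cast
        rw [div_sub_div _ _ (by linarith) (by linarith),
          div_le_div_iff₀ (by positivity) (mul_pos (by linarith) (by linarith))]
        nlinarith
      have h2 : (a : ℝ) / b ^ 2 = a * (1 / b ^ 2) := by ring
      rw [h2]
      nlinarith
  have hb' : (a : ℝ) ≤ b := by exact_mod_cast hab
  have h1 : (0 : ℝ) ≤ 1 / (b - 1 / 2) := one_div_nonneg.2 (by linarith)
  have h2 : (a : ℝ) * (1 / (a - 1 / 2)) ≤ 2 := by
    rw [mul_one_div, div_le_iff₀ (by linarith)]; linarith
  nlinarith

/-- The logarithmic sum of `1` over `[a, b)`. -/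
lemma sum_Ico_one_div_le {a b s : ℕ} (ha : 1 ≤ a) (hb : b ≤ s + 1) :
    ∑ n ∈ Finset.Ico a b, (1 : ℝ) / n ≤ 1 + Real.log s := by
  refine le_trans ?_ (harmonic_le_one_add_log s)
  rw [harmonic_eq_sum_Icc]
  push_cast
  simp only [one_div]
  refine Finset.sum_le_sum_of_subset_of_nonneg (fun n hn => ?_) fun _ _ _ => by positivity
  rw [Finset.mem_Ico] at hn
  rw [Finset.mem_Icc]; omega

/-- Second order Taylor bound for `|θ| ≤ 1`; for larger `θ` the triangle inequality gives `2 |θ| ≤ 2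
θ ^ 2`. -/
lemma norm_exp_I_mul_sub_le (θ : ℝ) :
    ‖Complex.exp (Complex.I * θ) - 1 - Complex.I * θ‖ ≤ 2 * θ ^ 2 := by
  rcases le_or_gt |θ| 1 with h | h
  · have := Complex.norm_exp_sub_one_sub_id_le (x := Complex.I * θ) (by simpa using h)
    refine this.trans ?_
    simp only [norm_mul, Complex.norm_I, one_mul, Complex.norm_real, Real.norm_eq_abs, sq_abs]
    nlinarith [sq_nonneg θ]
  · refine (norm_sub_le _ _).trans ?_
    have := Real.norm_exp_I_mul_ofReal_sub_one_le (x := θ)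
    simp only [norm_mul, Complex.norm_I, one_mul, Complex.norm_real, Real.norm_eq_abs] at this ⊢
    nlinarith [sq_abs θ]

/-! ### Logarithmic sums of a twist over a single scale -/

namespace SignedShifts

lemma norm_sum_twist_div_le_sum (l : SignedShifts) (s : ℕ) (I : Finset ℕ) :
    ‖∑ n ∈ I, twist l s n / n‖ ≤ ∑ n ∈ I, (1 : ℝ) / n := by
  refine (norm_sum_le _ _).trans (Finset.sum_le_sum fun n _ => ?_)
  rw [norm_div, norm_twist, Complex.norm_natCast]

/-- In the range `s ^ (1 / (k + 1)) ≤ n ≤ s ^ (1 / k)`, the logarithmic sums of a twist of order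
`k` are bounded. -/
lemma exists_norm_sum_twist_le {l : SignedShifts} {k : ℕ} (hl : ∀ i < k, moment i l = 0)
    (hk : moment k l ≠ 0) :
    ∃ B : ℝ, ∃ n₀ : ℕ, 0 < n₀ ∧ ∀ s a b : ℕ, n₀ ≤ a → a ≤ b → 0 < s → s ≤ a ^ (k + 1) →
      b ^ k ≤ s → ‖∑ n ∈ Finset.Ico a b, twist l s n / n‖ ≤ B := by
  obtain ⟨B, hB, n₀, hn₀, H⟩ := exists_abs_logPhase_succ_sub_le hl
  -- `C / n ^ (k + 1)` is the main term of the phase increment.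
  set C : ℝ := (-1 : ℝ) ^ k * moment k l with hC
  have hC0 : C ≠ 0 := mul_ne_zero (by simp) (by exact_mod_cast hk)
  have hC0' : 0 < |C| := abs_pos.2 hC0
  refine ⟨(2 + 2 * (2 * (B + |C|) ^ 2 + B)) / |C|, n₀, hn₀, fun s a b hna hab hs hsa hbs => ?_⟩
  have hs' : (0 : ℝ) < s := by exact_mod_cast hs
  have hsa' : (s : ℝ) ≤ a ^ (k + 1) := by exact_mod_cast hsa
  have hbs' : (b : ℝ) ^ k ≤ s := by exact_mod_cast hbs
  have ha : 1 ≤ a := hn₀.trans_le hna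
  have ha' : (1 : ℝ) ≤ a := by exact_mod_cast ha
  -- To first order `n ^ k * (twist (n + 1) - twist n)` is `i C s * twist n / n`. Summation by parts
  -- bounds the sum of the former by `2 b ^ k ≤ 2 s`, and dividing by `|C| s` will leave a constant.
  have main := norm_sum_Ico_mul_sub_le (fun n => (n : ℝ) ^ k) (twist l s) hab
    (fun n => (norm_twist l s n).le)
  rw [sum_Ico_abs_sub_of_monotone (w := fun n => (n : ℝ) ^ k) hab
    (fun n _ => by gcongr; simp), abs_of_nonneg (by positivity),
    abs_of_nonneg (by positivity)] at main
  -- The quadratic term of the exponential and the phase error are both `O(s a / n ^ 2)`; for the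
  -- former this is where `s ≤ a ^ (k + 1)` enters.
  have err : ∀ n ∈ Finset.Ico a b, ‖(((n : ℝ) ^ k : ℝ) : ℂ) * (twist l s (n + 1) - twist l s n) -
      Complex.I * C * s * (twist l s n / n)‖ ≤ s * (2 * (B + |C|) ^ 2 + B) * (a / n ^ 2) := by
    intro n hn
    rw [Finset.mem_Ico] at hn
    have hn1 : 1 ≤ n := ha.trans hn.1
    have hn' : (1 : ℝ) ≤ n := by exact_mod_cast hn1
    have hn0 : (n : ℝ) ≠ 0 := by positivity
    have hn0c : (n : ℂ) ≠ 0 := by exact_mod_cast hn0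
    have han : (a : ℝ) ≤ n := by exact_mod_cast hn.1
    set γ : ℝ := logPhase l (n + 1 : ℕ) - logPhase l n with hγ
    have h1 : |γ - C / n ^ (k + 1)| ≤ B / n ^ (k + 2) := H n (hna.trans hn.1)
    have h2 : twist l s (n + 1) = twist l s n * Complex.exp (Complex.I * ((s * γ : ℝ) : ℂ)) := by
      rw [twist, twist, ← Complex.exp_add, hγ]; congr 1; push_cast; ring
    have h3 : |γ| ≤ (B + |C|) / n ^ (k + 1) := by
      have e : |γ| ≤ |γ - C / n ^ (k + 1)| + |C / n ^ (k + 1)| := by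
        simpa using abs_add_le (γ - C / n ^ (k + 1)) (C / n ^ (k + 1))
      have e1 : |C / (n : ℝ) ^ (k + 1)| = |C| / n ^ (k + 1) := by
        rw [abs_div, abs_of_nonneg (by positivity : (0 : ℝ) ≤ n ^ (k + 1))]
      have e2 : B / (n : ℝ) ^ (k + 2) ≤ B / n ^ (k + 1) := by
        gcongr
        norm_num
      rw [add_div]; linarith
    have h4 : (((n : ℝ) ^ k : ℝ) : ℂ) * (twist l s (n + 1) - twist l s n) -
        Complex.I * C * s * (twist l s n / n) = (((n : ℝ) ^ k : ℝ) : ℂ) * twist l s n *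
        ((Complex.exp (Complex.I * ((s * γ : ℝ) : ℂ)) - 1 - Complex.I * ((s * γ : ℝ) : ℂ)) +
          Complex.I * ((s * (γ - C / n ^ (k + 1)) : ℝ) : ℂ)) := by
      rw [h2]; push_cast; field_simp; ring
    rw [h4, norm_mul, norm_mul, norm_twist, mul_one, Complex.norm_real, Real.norm_eq_abs,
      abs_of_nonneg (by positivity)]
    have h5 : ‖(Complex.exp (Complex.I * ((s * γ : ℝ) : ℂ)) - 1 - Complex.I * ((s * γ : ℝ) : ℂ)) +
          Complex.I * ((s * (γ - C / n ^ (k + 1)) : ℝ) : ℂ)‖ ≤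
        2 * (s * ((B + |C|) / n ^ (k + 1))) ^ 2 + s * (B / n ^ (k + 2)) := by
      refine (norm_add_le _ _).trans (add_le_add ((norm_exp_I_mul_sub_le _).trans ?_) ?_)
      · rw [← sq_abs, abs_mul, abs_of_pos hs']
        gcongr
      · rw [norm_mul, Complex.norm_I, one_mul, Complex.norm_real, Real.norm_eq_abs, abs_mul,
          abs_of_pos hs']
        gcongr
    refine (mul_le_mul_of_nonneg_left h5 (by positivity)).trans ?_
    have h6 : (n : ℝ) ^ k * (2 * (s * ((B + |C|) / n ^ (k + 1))) ^ 2 + s * (B / n ^ (k + 2))) =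
        s * (2 * (B + |C|) ^ 2 * (s / n ^ (k + 2)) + B * (1 / n ^ 2)) := by
      field_simp
      ring
    have h7 : (s : ℝ) / n ^ (k + 2) ≤ a / n ^ 2 := by
      rw [div_le_div_iff₀ (by positivity) (by positivity)]
      calc (s : ℝ) * n ^ 2 ≤ (a : ℝ) ^ (k + 1) * n ^ 2 := by gcongr
        _ = (a : ℝ) * a ^ k * n ^ 2 := by ring
        _ ≤ (a : ℝ) * n ^ k * n ^ 2 := by gcongr
        _ = (a : ℝ) * n ^ (k + 2) := by ring
    have h8 : (1 : ℝ) / n ^ 2 ≤ a / n ^ 2 := by gcongr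
    rw [h6, mul_assoc (s : ℝ) (_ + _), add_mul]
    gcongr
  have tot : ‖Complex.I * C * s * ∑ n ∈ Finset.Ico a b, twist l s n / n‖ ≤
      2 * s + s * (2 * (B + |C|) ^ 2 + B) * 2 := by
    have e : Complex.I * C * s * ∑ n ∈ Finset.Ico a b, twist l s n / n =
        ∑ n ∈ Finset.Ico a b, (((n : ℝ) ^ k : ℝ) : ℂ) * (twist l s (n + 1) - twist l s n) -
        ∑ n ∈ Finset.Ico a b, ((((n : ℝ) ^ k : ℝ) : ℂ) * (twist l s (n + 1) - twist l s n) -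
          Complex.I * C * s * (twist l s n / n)) := by
      rw [Finset.sum_sub_distrib, Finset.mul_sum]; ring
    rw [e]
    refine (norm_sub_le _ _).trans (add_le_add (main.trans ?_) ?_)
    · linarith
    · refine (norm_sum_le _ _).trans ((Finset.sum_le_sum err).trans ?_)
      rw [← Finset.mul_sum]
      gcongr
      exact sum_Ico_div_sq_le ha hab
  rw [norm_mul, norm_mul, norm_mul, Complex.norm_I, one_mul, Complex.norm_real, Real.norm_eq_abs,
    Complex.norm_natCast] at tot
  rw [le_div_iff₀ hC0']
  have : s * (‖∑ n ∈ Finset.Ico a b, twist l s n / n‖ * |C|) ≤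
      s * (2 + 2 * (2 * (B + |C|) ^ 2 + B)) := by linarith
  exact le_of_mul_le_mul_left this hs'

/-- In the range `s ^ (1 / k) ≤ n`, a twist whose moments of order less than `k` vanish differs
from `1` by a bounded amount in logarithmic sum. -/
lemma exists_norm_sum_twist_sub_le {l : SignedShifts} {k : ℕ} (hl : ∀ i < k, moment i l = 0)
    (hk : 0 < k) :
    ∃ B : ℝ, ∃ n₀ : ℕ, 0 < n₀ ∧ ∀ s a b : ℕ, n₀ ≤ a → a ≤ b → s ≤ a ^ k →
      ‖∑ n ∈ Finset.Ico a b, twist l s n / n - ∑ n ∈ Finset.Ico a b, (1 : ℂ) / n‖ ≤ B := by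
  obtain ⟨B, hB, n₀, hn₀, H⟩ := exists_norm_twist_sub_one_le hl hk
  refine ⟨B * 2, n₀, hn₀, fun s a b hna hab hsa => ?_⟩
  have ha : 1 ≤ a := hn₀.trans_le hna
  rw [← Finset.sum_sub_distrib]
  refine (norm_sum_le _ _).trans ?_
  calc _ ≤ ∑ n ∈ Finset.Ico a b, B * ((a : ℝ) / n ^ 2) := ?_
    _ ≤ B * 2 := by rw [← Finset.mul_sum]; gcongr; exact sum_Ico_div_sq_le ha hab
  refine Finset.sum_le_sum fun n hn => ?_
  rw [Finset.mem_Ico] at hn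
  have hn' : (1 : ℝ) ≤ n := by exact_mod_cast ha.trans hn.1
  have han : (a : ℝ) ≤ n := by exact_mod_cast hn.1
  have hsa' : (s : ℝ) ≤ a ^ k := by exact_mod_cast hsa
  rw [← sub_div, norm_div, Complex.norm_natCast, div_le_iff₀ (by positivity)]
  refine (H s n (hna.trans hn.1)).trans ?_
  rw [mul_div_assoc, mul_assoc]
  gcongr
  rw [div_mul_eq_mul_div, div_le_div_iff₀ (by positivity) (by positivity)]
  obtain ⟨j, rfl⟩ := Nat.exists_eq_add_of_lt hk
  rw [zero_add] at hsa' ⊢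
  have hna' : (0 : ℝ) ≤ a := by positivity
  calc (s : ℝ) * n ^ 2 ≤ (a : ℝ) ^ (j + 1) * n ^ 2 := by gcongr
    _ = (a : ℝ) * a ^ j * n ^ 2 := by ring
    _ ≤ (a : ℝ) * n ^ j * n ^ 2 := by gcongr
    _ = (a : ℝ) * n * n ^ (j + 1) := by ring

end SignedShifts

/-! ### The van der Corput inequality for logarithmic sums -/

/-- Replacing `E` by its mean over `H` shifts costs at most `2 H`, by almost invariance of
logarithmic sums. Cauchy–Schwarz and expansion of the square then leave `H` diagonal terms bounded
by `X` and at most `H ^ 2` off-diagonal ones bounded by `Y`. -/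
lemma norm_sum_Ico_div_le_vanDerCorput (E : ℕ → ℂ) (hE : ∀ n, ‖E n‖ ≤ 1) {a b : ℕ}
    (ha : 1 ≤ a) (hab : a ≤ b) {X Y : ℝ} (hX : ∑ n ∈ Finset.Ico a b, (1 : ℝ) / n ≤ X) (hY : 0 ≤ Y)
    {H : ℕ} (hH : 0 < H)
    (hEY : ∀ h < H, ∀ h' < H, h ≠ h' →
      ‖∑ n ∈ Finset.Ico a b, E (n + h) * starRingEnd ℂ (E (n + h')) / n‖ ≤ Y) :
    ‖∑ n ∈ Finset.Ico a b, E n / n‖ ≤ 2 * H + √(X * (X / H + Y)) := by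
  have hH' : (0 : ℝ) < H := by exact_mod_cast hH
  have hX0 : 0 ≤ X := le_trans (Finset.sum_nonneg fun _ _ => by positivity) hX
  set W : ℕ → ℂ := fun n => ∑ h ∈ Finset.range H, E (n + h) with hW
  have h1 : ‖∑ n ∈ Finset.Ico a b, W n / n - H * ∑ n ∈ Finset.Ico a b, E n / n‖ ≤ H * (2 * H) := by
    have e : ∑ n ∈ Finset.Ico a b, W n / n - H * ∑ n ∈ Finset.Ico a b, E n / n =
        ∑ h ∈ Finset.range H,
          (∑ n ∈ Finset.Ico a b, E (n + h) / n - ∑ n ∈ Finset.Ico a b, E n / n) := by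
      rw [Finset.sum_sub_distrib, Finset.sum_const, Finset.card_range, nsmul_eq_mul,
        Finset.sum_comm]
      simp only [hW, Finset.sum_div]
    rw [e]
    refine (norm_sum_le _ _).trans ?_
    calc _ ≤ ∑ h ∈ Finset.range H, (2 * H : ℝ) := Finset.sum_le_sum fun h hh => by
            have : (h : ℝ) ≤ H := by exact_mod_cast (Finset.mem_range.1 hh).le
            exact (norm_sum_Ico_add_div_sub_le E hE ha hab h).trans (by linarith)
      _ = _ := by simp
  have h2 : ∑ n ∈ Finset.Ico a b, ‖W n‖ ^ 2 / n ≤ H * X + H ^ 2 * Y := by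
    have e : ((∑ n ∈ Finset.Ico a b, ‖W n‖ ^ 2 / n : ℝ) : ℂ) =
        ∑ h ∈ Finset.range H, ∑ h' ∈ Finset.range H,
          ∑ n ∈ Finset.Ico a b, E (n + h) * starRingEnd ℂ (E (n + h')) / n := by
      push_cast
      rw [Finset.sum_congr rfl fun h _ => Finset.sum_comm, Finset.sum_comm]
      refine Finset.sum_congr rfl fun n _ => ?_
      rw [← Complex.mul_conj', hW, map_sum, Finset.sum_mul_sum, Finset.sum_div]
      exact Finset.sum_congr rfl fun h _ => by rw [Finset.sum_div]
    have e2 : ∑ n ∈ Finset.Ico a b, ‖W n‖ ^ 2 / n =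
        ‖((∑ n ∈ Finset.Ico a b, ‖W n‖ ^ 2 / n : ℝ) : ℂ)‖ := by
      rw [Complex.norm_real, Real.norm_eq_abs, abs_of_nonneg]
      exact Finset.sum_nonneg fun _ _ => by positivity
    rw [e2, e]
    refine (norm_sum_le _ _).trans ?_
    calc _ ≤ ∑ h ∈ Finset.range H, (X + H * Y) := Finset.sum_le_sum fun h hh => ?_
      _ = _ := by simp; ring
    refine (norm_sum_le _ _).trans ?_
    rw [← Finset.add_sum_erase _ _ hh]
    refine add_le_add ?_ ?_
    · refine (norm_sum_le _ _).trans (le_trans (Finset.sum_le_sum fun n _ => ?_) hX)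
      rw [norm_div, norm_mul, RCLike.norm_conj, Complex.norm_natCast]
      gcongr
      exact mul_le_one₀ (hE _) (norm_nonneg _) (hE _)
    · calc _ ≤ ∑ h' ∈ (Finset.range H).erase h, Y := Finset.sum_le_sum fun h' hh' =>
            hEY h (Finset.mem_range.1 hh) h' (Finset.mem_range.1 (Finset.mem_of_mem_erase hh'))
              (Finset.ne_of_mem_erase hh').symm
        _ ≤ H * Y := by
            rw [Finset.sum_const, nsmul_eq_mul]
            gcongr
            exact (Finset.card_erase_le).trans (Finset.card_range H).le
  have h3 : ‖∑ n ∈ Finset.Ico a b, W n / n‖ ^ 2 ≤ X * (H * X + H ^ 2 * Y) := by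
    calc _ ≤ (∑ n ∈ Finset.Ico a b, ‖W n / n‖) ^ 2 := by gcongr; exact norm_sum_le _ _
      _ ≤ (∑ n ∈ Finset.Ico a b, (1 : ℝ) / n) * ∑ n ∈ Finset.Ico a b, ‖W n‖ ^ 2 / n := by
          refine Finset.sum_sq_le_sum_mul_sum_of_sq_le_mul _ (fun _ _ => by positivity)
            (fun _ _ => by positivity) fun n _ => ?_
          rw [norm_div, Complex.norm_natCast, div_pow, one_div_mul_eq_div, div_div, sq (n : ℝ)]
      _ ≤ _ := by gcongr
  have h4 : ‖∑ n ∈ Finset.Ico a b, W n / n‖ ≤ H * √(X * (X / H + Y)) := by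
    refine abs_le_of_sq_le_sq' ?_ (by positivity) |>.2
    rw [mul_pow, Real.sq_sqrt (by positivity)]
    refine h3.trans (le_of_eq ?_)
    field_simp
  have h5 : H * ‖∑ n ∈ Finset.Ico a b, E n / n‖ ≤ H * (2 * H + √(X * (X / H + Y))) := by
    calc _ = ‖(H : ℂ) * ∑ n ∈ Finset.Ico a b, E n / n‖ := by rw [norm_mul, Complex.norm_natCast]
      _ = ‖∑ n ∈ Finset.Ico a b, W n / n -
          (∑ n ∈ Finset.Ico a b, W n / n - H * ∑ n ∈ Finset.Ico a b, E n / n)‖ := by ring_nf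
      _ ≤ _ := norm_sub_le _ _
      _ ≤ H * √(X * (X / H + Y)) + H * (2 * H) := add_le_add h4 h1
      _ = _ := by ring
  exact le_of_mul_le_mul_left h5 hH'

/-- Cut an interval at a threshold, losing at most one point. -/
lemma exists_Ico_split (M : ℕ) {a b : ℕ} (hab : a ≤ b) :
    ∃ b₁ a₂, a ≤ b₁ ∧ b₁ ≤ a₂ ∧ a₂ ≤ b ∧ a₂ ≤ b₁ + 1 ∧ (b₁ = a ∨ b₁ ≤ M) ∧
      (a₂ = b ∨ M + 1 ≤ a₂) :=
  ⟨max a (min b M), min b (max a (M + 1)), by omega, by omega, by omega, by omega, by omega,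
    by omega⟩

lemma norm_sum_Ico_sub_le (f : ℕ → ℂ) (hf : ∀ n, ‖f n‖ ≤ 1) {a b b₁ a₂ : ℕ} (h₁ : a ≤ b₁)
    (h₂ : b₁ ≤ a₂) (h₃ : a₂ ≤ b) (h : a₂ ≤ b₁ + 1) :
    ‖∑ n ∈ Finset.Ico a b, f n - ∑ n ∈ Finset.Ico a₂ b, f n‖ ≤
      ‖∑ n ∈ Finset.Ico a b₁, f n‖ + 1 := by
  rw [← Finset.sum_Ico_consecutive f (h₁.trans h₂) h₃, ← Finset.sum_Ico_consecutive f h₁ h₂,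
    add_sub_cancel_right]
  refine (norm_add_le _ _).trans (add_le_add le_rfl ((norm_sum_le _ _).trans ?_))
  refine (Finset.sum_le_card_nsmul _ _ 1 fun n _ => hf n).trans ?_
  rw [Nat.card_Ico, nsmul_eq_mul, mul_one]
  exact_mod_cast (by omega : a₂ - b₁ ≤ 1)

lemma exists_pow_le_lt (k s : ℕ) (hs : 1 ≤ s) :
    ∃ M : ℕ, 1 ≤ M ∧ M ^ (k + 1) ≤ s ∧ s < (M + 1) ^ (k + 1) := by
  have h0 : 1 ^ (k + 1) ≤ s := by simpa using hs
  refine ⟨Nat.findGreatest (fun n => n ^ (k + 1) ≤ s) s,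
    Nat.le_findGreatest (P := fun n => n ^ (k + 1) ≤ s) hs h0,
    Nat.findGreatest_spec (P := fun n => n ^ (k + 1) ≤ s) hs h0, ?_⟩
  by_contra! hcon
  have h1 : Nat.findGreatest (fun n => n ^ (k + 1) ≤ s) s + 1 ≤ s :=
    (Nat.le_self_pow (by omega) _).trans hcon
  have := Nat.le_findGreatest (P := fun n => n ^ (k + 1) ≤ s) h1 hcon
  omega

lemma tendsto_log_natCast_atTop : Tendsto (fun s : ℕ => Real.log s) atTop atTop :=
  Real.tendsto_log_atTop.comp tendsto_natCast_atTop_atTop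

/-! ### Descent through the scales by van der Corput differencing -/

namespace SignedShifts

lemma norm_twist_div_le (l : SignedShifts) (s n : ℕ) : ‖twist l s n / n‖ ≤ 1 := by
  rw [norm_div, norm_twist, Complex.norm_natCast]
  rcases Nat.eq_zero_or_pos n with rfl | h
  · simp
  · rw [div_le_one (by exact_mod_cast h)]; exact_mod_cast h

/-- The logarithmic sums of a twist of order `k` over `s ^ (1 / K) ≤ n ≤ s ^ (1 / k)` are
`o(log s)`. -/
lemma eventually_norm_sum_twist_le {K : ℕ} (hK : 0 < K) (j : ℕ) :
    ∀ k, K ≤ k + j → ∀ l : SignedShifts, (∀ i < k, moment i l = 0) → moment k l ≠ 0 →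
      ∀ ε : ℝ, 0 < ε → ∀ᶠ s : ℕ in atTop, ∀ a b : ℕ, a ≤ b → s ≤ a ^ K → b ^ k ≤ s →
        ‖∑ n ∈ Finset.Ico a b, twist l s n / n‖ ≤ ε * Real.log s := by
  -- Downward induction on the order: `j` bounds `K - k`, and for `k ≥ K` the range of summation is
  -- empty.
  induction j with
  | zero =>
    intro k hKk l _ _ ε hε
    filter_upwards [eventually_ge_atTop 1] with s hs a b hab hsa hbs
    have ha : 0 < a := by
      rcases Nat.eq_zero_or_pos a with rfl | h
      · rw [zero_pow hK.ne'] at hsa; omega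
      · exact h
    have h1 : b ^ k ≤ a ^ k := hbs.trans (hsa.trans (Nat.pow_le_pow_right ha hKk))
    have h2 : b ≤ a := (Nat.pow_le_pow_iff_left (by omega)).1 h1
    rw [Finset.Ico_eq_empty_of_le h2, Finset.sum_empty, norm_zero]
    exact mul_nonneg hε.le (Real.log_natCast_nonneg s)
  | succ j ih =>
    intro k hKk l hl hk ε hε
    obtain ⟨B, n₀, hn₀, hB⟩ := exists_norm_sum_twist_le hl hk
    -- With `X = 2 log s` and `Y = ε ^ 2 / 64 * log s`, this makes `X / H ≤ Y`, so that `√(X * (X /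
    -- H + Y)) ≤ ε / 4 * log s`.
    obtain ⟨H, hH⟩ := exists_nat_gt (128 / ε ^ 2)
    have hH' : (0 : ℝ) < H := lt_trans (by positivity) hH
    have hH0 : 0 < H := by exact_mod_cast hH'
    have hD : ∀ h ∈ Finset.range H, ∀ h' ∈ Finset.range H, h ≠ h' → ∀ᶠ s : ℕ in atTop,
        ∀ a b : ℕ, a ≤ b → s ≤ a ^ K → b ^ (k + 1) ≤ s →
        ‖∑ n ∈ Finset.Ico a b, twist l s (n + h) * starRingEnd ℂ (twist l s (n + h')) / n‖ ≤
          ε ^ 2 / 64 * Real.log s := by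
      intro h _ h' _ hne
      -- For `h ≠ h'` the differenced list has order exactly `k + 1`, with leading moment `(k + 1) *
      -- (h - h') * moment k l`.
      have := ih (k + 1) (by omega) (translate h l ++ opposite (translate h' l))
        (fun i hi => by
          rw [moment_append, moment_opposite, moment_translate_eq hl _ i (by omega),
            moment_translate_eq hl _ i (by omega)]; ring)
        (by
          rw [moment_append, moment_opposite, moment_succ_translate hl, moment_succ_translate hl]
          have e : ((k : ℤ) + 1) * h * moment k l + moment (k + 1) l +
              -((k + 1) * h' * moment k l + moment (k + 1) l) =
              (k + 1) * (h - h') * moment k l := by ring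
          rw [e]
          refine mul_ne_zero (mul_ne_zero (by positivity) (sub_ne_zero.2 ?_)) hk
          exact_mod_cast hne) (ε ^ 2 / 64) (by positivity)
      filter_upwards [this] with s hs a b hab h1 h2
      simpa only [twist_mul_conj] using hs a b hab h1 h2
    have hD' : ∀ᶠ s : ℕ in atTop, ∀ h ∈ Finset.range H, ∀ h' ∈ Finset.range H, h ≠ h' →
        ∀ a b : ℕ, a ≤ b → s ≤ a ^ K → b ^ (k + 1) ≤ s →
        ‖∑ n ∈ Finset.Ico a b, twist l s (n + h) * starRingEnd ℂ (twist l s (n + h')) / n‖ ≤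
          ε ^ 2 / 64 * Real.log s := by
      refine (Finset.eventually_all _).2 fun h hh => (Finset.eventually_all _).2 fun h' hh' => ?_
      by_cases hne : h = h'
      · exact Eventually.of_forall fun s hn => absurd hne hn
      · filter_upwards [hD h hh h' hh' hne] with s hs _ using hs
    filter_upwards [hD', eventually_ge_atTop 1, eventually_ge_atTop (n₀ ^ K),
      tendsto_log_natCast_atTop.eventually_ge_atTop 1,
      tendsto_log_natCast_atTop.eventually_ge_atTop (2 * H / (ε / 4)),
      tendsto_log_natCast_atTop.eventually_ge_atTop (B / (ε / 4)),
      tendsto_log_natCast_atTop.eventually_ge_atTop (1 / (ε / 4))]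
      with s hs hs1 hsn hlog hlogH hlogB hlog1 a b hab hsa hbs
    rw [div_le_iff₀ (by positivity)] at hlogH hlogB hlog1
    have hεlog : 0 < ε * Real.log s := mul_pos hε (by linarith)
    have hna : n₀ ≤ a := (Nat.pow_le_pow_iff_left hK.ne').1 (hsn.trans hsa)
    -- Cut at `M = ⌊s ^ (1 / (k + 1))⌋`: differencing handles the part below, summation by parts the
    -- part above.
    obtain ⟨M, hM1, hMs, hsM⟩ := exists_pow_le_lt k s hs1
    obtain ⟨b₁, a₂, h1, h2, h3, h4, h5, h6⟩ := exists_Ico_split M hab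
    have low : ‖∑ n ∈ Finset.Ico a b₁, twist l s n / n‖ ≤ ε / 2 * Real.log s := by
      rcases h5 with rfl | h5
      · rw [Finset.Ico_self, Finset.sum_empty, norm_zero]; linarith
      have hb₁ : b₁ ^ (k + 1) ≤ s := (Nat.pow_le_pow_left h5 _).trans hMs
      have hX : ∑ n ∈ Finset.Ico a b₁, (1 : ℝ) / n ≤ 2 * Real.log s :=
        (sum_Ico_one_div_le (s := s) (hn₀.trans_le hna)
          (((Nat.le_self_pow (by omega) _).trans hb₁).trans (Nat.le_succ _))).trans (by linarith)
      refine (norm_sum_Ico_div_le_vanDerCorput (twist l s) (fun n => (norm_twist l s n).le)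
        (hn₀.trans_le hna) h1 hX (Y := ε ^ 2 / 64 * Real.log s) (by positivity) hH0
        fun h hh h' hh' hne => hs h (Finset.mem_range.2 hh) h' (Finset.mem_range.2 hh') hne a b₁ h1
          hsa hb₁).trans ?_
      have e : √(2 * Real.log s * (2 * Real.log s / H + ε ^ 2 / 64 * Real.log s)) ≤
          ε / 4 * Real.log s := by
        refine Real.sqrt_le_iff.2 ⟨by positivity, ?_⟩
        have e1 : 2 * Real.log s / H ≤ ε ^ 2 / 64 * Real.log s := by
          rw [div_le_iff₀ hH']
          rw [div_lt_iff₀ (by positivity)] at hH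
          nlinarith
        nlinarith
      linarith
    have high : ‖∑ n ∈ Finset.Ico a₂ b, twist l s n / n‖ ≤ ε / 4 * Real.log s := by
      rcases h6 with rfl | h6
      · rw [Finset.Ico_self, Finset.sum_empty, norm_zero]; linarith
      · exact (hB s a₂ b (hna.trans (h1.trans h2)) h3 hs1
          (hsM.le.trans (Nat.pow_le_pow_left h6 _)) hbs).trans (by linarith)
    have := norm_sum_Ico_sub_le _ (norm_twist_div_le l s) h1 h2 h3 h4
    have := norm_le_norm_add_norm_sub' (∑ n ∈ Finset.Ico a b, twist l s n / n)
      (∑ n ∈ Finset.Ico a₂ b, twist l s n / n)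
    linarith

end SignedShifts

/-! ### Asymptotics of the logarithmic sums of twists -/

lemma sum_Ico_one_div_eq_harmonic (N : ℕ) :
    ∑ n ∈ Finset.Ico 1 (N + 1), (1 : ℝ) / n = harmonic N := by
  rw [harmonic_eq_sum_Icc]
  push_cast
  simp only [one_div]
  rfl

lemma abs_harmonic_sub_log_le (N : ℕ) : |(harmonic N : ℝ) - Real.log N| ≤ 1 := by
  rcases Nat.eq_zero_or_pos N with rfl | hN
  · simp
  have h1 := harmonic_le_one_add_log N
  have h2 := log_add_one_le_harmonic N
  have hN' : (0 : ℝ) < N := by exact_mod_cast hN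
  have h3 : Real.log N ≤ Real.log (N + 1 : ℕ) := Real.log_le_log hN' (by push_cast; linarith)
  rw [abs_le]; constructor <;> linarith

lemma log_le_log_div_of_pow_le {M k s : ℕ} (hM : 1 ≤ M) (h : M ^ (k + 1) ≤ s) :
    Real.log M ≤ Real.log s / (k + 1 : ℕ) := by
  have hM' : (0 : ℝ) < M := by exact_mod_cast hM
  have hk : (0 : ℝ) < (k + 1 : ℕ) := by positivity
  rw [le_div_iff₀ hk, mul_comm, ← Real.log_pow]
  exact Real.log_le_log (by positivity) (by exact_mod_cast h)

lemma log_div_le_log_of_le_pow {M k s : ℕ} (hs : 1 ≤ s) (h : s ≤ M ^ (k + 1)) :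
    Real.log s / (k + 1 : ℕ) ≤ Real.log M := by
  have hs' : (0 : ℝ) < s := by exact_mod_cast hs
  have hk : (0 : ℝ) < (k + 1 : ℕ) := by positivity
  rw [div_le_iff₀ hk, mul_comm, ← Real.log_pow]
  exact Real.log_le_log (by positivity) (by exact_mod_cast h)

namespace SignedShifts

lemma norm_sum_twist_le_one_add_log (l : SignedShifts) {s b M k : ℕ} (hM : 1 ≤ M) (hb : b ≤ M)
    (h : M ^ (k + 1) ≤ s) :
    ‖∑ n ∈ Finset.Ico 1 b, twist l s n / n‖ ≤ 1 + Real.log s / (k + 1 : ℕ) := by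
  have h1 := norm_sum_twist_div_le_sum l s (Finset.Ico 1 b)
  have h2 := sum_Ico_one_div_le (a := 1) (b := b) (s := M) le_rfl (by omega)
  have h3 := log_le_log_div_of_pow_le hM h
  linarith

/-- The descent reaches down to `s ^ (1 / (K + 1))`. Below that the trivial bound `1 + log s / (K +
1)` is already small compared with `log s` once `K` is large in terms of `1 / ε`. -/
lemma eventually_norm_sum_twist_le_of_order {l : SignedShifts} {k : ℕ}
    (hl : ∀ i < k, moment i l = 0) (hk : moment k l ≠ 0) {ε : ℝ} (hε : 0 < ε) :
    ∀ᶠ s : ℕ in atTop, ∀ b : ℕ, b ^ k ≤ s →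
      ‖∑ n ∈ Finset.Ico 1 b, twist l s n / n‖ ≤ ε * Real.log s := by
  obtain ⟨K, hK⟩ := exists_nat_gt (4 / ε)
  have hK' : (0 : ℝ) < (K + 1 : ℕ) := by positivity
  have hKε : 1 / ((K + 1 : ℕ) : ℝ) ≤ ε / 4 := by
    rw [div_le_iff₀ hK']
    rw [div_lt_iff₀ hε] at hK
    push_cast; nlinarith
  filter_upwards [eventually_norm_sum_twist_le (Nat.succ_pos K) (K + 1) k (by omega) l hl hk
    (ε / 4) (by positivity), eventually_ge_atTop 1,
    tendsto_log_natCast_atTop.eventually_ge_atTop (2 / (ε / 4))] with s hs hs1 hlog b hb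
  rw [div_le_iff₀ (by positivity)] at hlog
  have hlog0 : 0 ≤ Real.log s := Real.log_natCast_nonneg s
  rcases Nat.lt_or_ge b 1 with hb1 | hb1
  · rw [Finset.Ico_eq_empty_of_le hb1.le, Finset.sum_empty, norm_zero]; positivity
  obtain ⟨M, hM1, hMs, hsM⟩ := exists_pow_le_lt K s hs1
  obtain ⟨b₁, a₂, h1, h2, h3, h4, h5, h6⟩ := exists_Ico_split M hb1
  have low : ‖∑ n ∈ Finset.Ico 1 b₁, twist l s n / n‖ ≤ 1 + ε / 4 * Real.log s := by
    have := norm_sum_twist_le_one_add_log l (s := s) (b := b₁) hM1 (by omega) hMs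
    rw [div_eq_mul_one_div] at this
    nlinarith
  have high : ‖∑ n ∈ Finset.Ico a₂ b, twist l s n / n‖ ≤ ε / 4 * Real.log s := by
    rcases h6 with rfl | h6
    · rw [Finset.Ico_self, Finset.sum_empty, norm_zero]; positivity
    · exact hs a₂ b h3 (hsM.le.trans (Nat.pow_le_pow_left h6 _)) hb
  have := norm_sum_Ico_sub_le _ (norm_twist_div_le l s) h1 h2 h3 h4
  have := norm_le_norm_add_norm_sub' (∑ n ∈ Finset.Ico 1 b, twist l s n / n)
    (∑ n ∈ Finset.Ico a₂ b, twist l s n / n)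
  linarith

/-- Past `s ^ (1 / (k + 1))` the twist is nearly `1` and contributes `log N - log s / (k + 1)`. The
bound `η` for the initial stretch is kept as an input, since `moment (k + 1) l` may vanish here: it
will be `o(log s)` if that moment is nonzero, and the trivial bound if all moments vanish. -/
lemma exists_norm_sum_twist_sub_max_le {l : SignedShifts} {k : ℕ}
    (hl : ∀ i < k + 1, moment i l = 0) :
    ∃ C : ℝ, ∀ᶠ s : ℕ in atTop, ∀ (η : ℝ),
      (∀ b : ℕ, b ^ (k + 1) ≤ s → ‖∑ n ∈ Finset.Ico 1 b, twist l s n / n‖ ≤ η) → ∀ N : ℕ,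
      ‖∑ n ∈ Finset.Ico 1 (N + 1), twist l s n / n -
        (max 0 (Real.log N - Real.log s / (k + 1 : ℕ)) : ℝ)‖ ≤ η + C := by
  obtain ⟨B, n₀, hn₀, hB⟩ := exists_norm_sum_twist_sub_le hl (Nat.succ_pos k)
  refine ⟨|B| + 5, ?_⟩
  filter_upwards [eventually_ge_atTop 1, eventually_ge_atTop (n₀ ^ (k + 1))] with s hs hsn η hη N
  obtain ⟨M, hM1, hMs, hsM⟩ := exists_pow_le_lt k s hs
  have hM1' : (1 : ℝ) ≤ M := by exact_mod_cast hM1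
  rcases le_or_gt N M with hNM | hNM
  · have hN : N ^ (k + 1) ≤ s := (Nat.pow_le_pow_left hNM _).trans hMs
    have hmax : max 0 (Real.log N - Real.log s / (k + 1 : ℕ)) = 0 := by
      refine max_eq_left ?_
      rcases Nat.eq_zero_or_pos N with rfl | hN0
      · have := Real.log_natCast_nonneg s
        have : 0 ≤ Real.log s / (k + 1 : ℕ) := by positivity
        simpa using this
      · linarith [log_le_log_div_of_pow_le hN0 hN]
    rw [hmax, Complex.ofReal_zero, sub_zero]
    rcases Nat.eq_zero_or_pos N with rfl | hN0
    · have := (norm_nonneg _).trans (hη 0 (by simp))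
      rw [Finset.Ico_self, Finset.sum_empty, norm_zero]
      positivity
    · rw [Finset.sum_Ico_succ_top hN0]
      refine (norm_add_le _ _).trans (add_le_add (hη N hN) ((norm_twist_div_le l s N).trans ?_))
      linarith [abs_nonneg B]
  · have hlogM : Real.log s / (k + 1 : ℕ) ≤ Real.log M + 1 := by
      refine (log_div_le_log_of_le_pow hs hsM.le).trans ?_
      have h2 : Real.log (M + 1 : ℕ) ≤ Real.log (2 * M) :=
        Real.log_le_log (by positivity) (by push_cast; linarith)
      rw [Real.log_mul (by norm_num) (by positivity)] at h2
      have := Real.log_two_lt_d9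
      linarith
    have hlogM' := log_le_log_div_of_pow_le hM1 hMs
    have hlogN : Real.log (M + 1 : ℕ) ≤ Real.log N :=
      Real.log_le_log (by positivity) (by exact_mod_cast hNM)
    rw [max_eq_right (by linarith [log_div_le_log_of_le_pow hs hsM.le])]
    have h1 := hη M hMs
    have h2 := norm_sum_Ico_sub_le _ (norm_twist_div_le l s) hM1 (Nat.le_succ M)
      (Nat.succ_le_succ hNM.le) le_rfl
    have h3 := hB s (M + 1) (N + 1) ((Nat.pow_le_pow_iff_left (Nat.succ_ne_zero k)).1
      (hsn.trans hsM.le)) (by omega) hsM.le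
    have h4 : ∑ n ∈ Finset.Ico (M + 1) (N + 1), (1 : ℂ) / n = ((harmonic N - harmonic M : ℝ) : ℂ) := by
      have := Finset.sum_Ico_consecutive (fun n : ℕ => (1 : ℝ) / n) (by omega : 1 ≤ M + 1)
        (by omega : M + 1 ≤ N + 1)
      rw [sum_Ico_one_div_eq_harmonic, sum_Ico_one_div_eq_harmonic] at this
      rw [← this, add_sub_cancel_left]
      push_cast
      rfl
    rw [h4] at h3
    -- Each harmonic number is within `1` of the logarithm, and rounding the threshold `s ^ (1 / (k
    -- + 1))` to the integer `M` costs at most another `1`.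
    have h5 : ‖((harmonic N - harmonic M : ℝ) : ℂ) -
        ((Real.log N - Real.log s / (k + 1 : ℕ) : ℝ) : ℂ)‖ ≤ 3 := by
      rw [← Complex.ofReal_sub, Complex.norm_real, Real.norm_eq_abs, abs_le]
      have a1 := abs_le.1 (abs_harmonic_sub_log_le N)
      have a2 := abs_le.1 (abs_harmonic_sub_log_le M)
      constructor <;> linarith [a1.1, a1.2, a2.1, a2.2]
    have h6 := norm_add₃_le (a := ∑ n ∈ Finset.Ico 1 (N + 1), twist l s n / n -
        ∑ n ∈ Finset.Ico (M + 1) (N + 1), twist l s n / n)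
      (b := ∑ n ∈ Finset.Ico (M + 1) (N + 1), twist l s n / n - ((harmonic N - harmonic M : ℝ) : ℂ))
      (c := ((harmonic N - harmonic M : ℝ) : ℂ) -
        ((Real.log N - Real.log s / (k + 1 : ℕ) : ℝ) : ℂ))
    rw [sub_add_sub_cancel, sub_add_sub_cancel] at h6
    refine h6.trans ?_
    have := le_abs_self B
    linarith

/-- The limit of the correlations encoded by a list of signed shifts. -/
noncomputable def correlation (c : ℝ) (l : SignedShifts) : ℝ :=
  open Classical in
  if ∀ i, moment i l = 0 then 1
  else if moment 0 l ≠ 0 then 0 else max 0 (1 - c / sInf {k : ℕ | moment k l ≠ 0})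

lemma correlation_of_forall {c : ℝ} {l : SignedShifts} (h : ∀ i, moment i l = 0) :
    correlation c l = 1 := by
  rw [correlation, if_pos h]

lemma correlation_of_moment_zero_ne {c : ℝ} {l : SignedShifts} (h : moment 0 l ≠ 0) :
    correlation c l = 0 := by
  rw [correlation, if_neg fun h' => h (h' 0), if_pos h]

lemma correlation_of_order {c : ℝ} {l : SignedShifts} {k : ℕ} (hl : ∀ i < k + 1, moment i l = 0)
    (hk : moment (k + 1) l ≠ 0) : correlation c l = max 0 (1 - c / (k + 1 : ℕ)) := by
  have : sInf {k : ℕ | moment k l ≠ 0} = k + 1 :=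
    le_antisymm (Nat.sInf_le hk) (le_csInf ⟨k + 1, hk⟩ fun j hj => by
      by_contra! hlt
      exact hj (hl j hlt))
  rw [correlation, if_neg fun h' => hk (h' _), if_neg (not_not.2 (hl 0 (Nat.succ_pos k))), this]

lemma moments_trichotomy (l : SignedShifts) :
    (∀ i, moment i l = 0) ∨ moment 0 l ≠ 0 ∨
      ∃ k, (∀ i < k + 1, moment i l = 0) ∧ moment (k + 1) l ≠ 0 := by
  classical
  by_cases h : ∃ k, moment k l ≠ 0
  · right
    have h1 := Nat.find_spec h
    have h2 : ∀ i < Nat.find h, moment i l = 0 := fun i hi => not_not.1 (Nat.find_min h hi)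
    generalize Nat.find h = k at h1 h2
    cases k with
    | zero => exact Or.inl h1
    | succ k => exact Or.inr ⟨k, h2, h1⟩
  · left
    push Not at h
    exact h

/-- The correlation is a function of the order alone; the two hypotheses say that both lists have
the same initial runs of vanishing moments. -/
lemma correlation_congr (c : ℝ) {l l' : SignedShifts}
    (h : ∀ d, (∀ i < d, moment i l = 0) → ∀ i < d, moment i l' = 0)
    (h' : ∀ d, (∀ i < d, moment i l' = 0) → ∀ i < d, moment i l = 0) :
    correlation c l = correlation c l' := by
  rcases moments_trichotomy l with h0 | h0 | ⟨k, hl, hk⟩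
  · rw [correlation_of_forall h0,
      correlation_of_forall fun i => h (i + 1) (fun j _ => h0 j) i (Nat.lt_succ_self i)]
  · rw [correlation_of_moment_zero_ne h0, correlation_of_moment_zero_ne fun h1 =>
      h0 (h' 1 (fun i hi => by rw [Nat.lt_one_iff.1 hi, h1]) 0 one_pos)]
  · rw [correlation_of_order hl hk, correlation_of_order (h _ hl) fun h1 =>
      hk (h' (k + 2) (fun i hi => ?_) (k + 1) (Nat.lt_succ_self _))]
    rcases (Nat.lt_succ_iff.1 hi).eq_or_lt with rfl | hi
    · exact h1
    · exact h _ hl i hi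

lemma tendsto_div_log_of_eventually {l : SignedShifts} (g : ℕ → ℕ → ℝ)
    (hg : ∀ ε : ℝ, 0 < ε → ∀ᶠ s : ℕ in atTop, ∀ N : ℕ,
      ‖∑ n ∈ Finset.Ico 1 (N + 1), twist l s n / n - g s N‖ ≤ ε * Real.log s)
    {S N : ℕ → ℕ} (hS : Tendsto S atTop atTop) {G : ℝ}
    (hG : Tendsto (fun m => g (S m) (N m) / Real.log (S m)) atTop (𝓝 G)) :
    Tendsto (fun m => (∑ n ∈ Finset.Ico 1 (N m + 1), twist l (S m) n / n) / Real.log (S m)) atTop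
      (𝓝 (G : ℂ)) := by
  have h1 : Tendsto (fun m => (∑ n ∈ Finset.Ico 1 (N m + 1), twist l (S m) n / n -
      g (S m) (N m)) / Real.log (S m)) atTop (𝓝 0) := by
    rw [Metric.tendsto_nhds]
    intro ε hε
    filter_upwards [hS.eventually (hg (ε / 2) (by positivity)),
      hS.eventually (tendsto_log_natCast_atTop.eventually_ge_atTop 1)] with m hm hlog
    rw [dist_zero_right, norm_div, Complex.norm_real, Real.norm_eq_abs,
      abs_of_nonneg (by linarith), div_lt_iff₀ (by linarith)]
    refine (hm (N m)).trans_lt ?_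
    nlinarith
  have h2 := h1.add ((Complex.continuous_ofReal.tendsto G).comp hG)
  rw [zero_add] at h2
  refine h2.congr fun m => ?_
  simp only [Function.comp_apply, Complex.ofReal_div]
  rw [← add_div, sub_add_cancel]

/-- The logarithmic sums of a twist with exponent `S m` up to `N m ≈ (S m) ^ A`. -/
theorem tendsto_sum_twist (l : SignedShifts) {S N : ℕ → ℕ} (hS : Tendsto S atTop atTop) {A : ℝ}
    (hA : 0 < A) (hN : Tendsto (fun m => Real.log (N m) / Real.log (S m)) atTop (𝓝 A)) :
    Tendsto (fun m => (∑ n ∈ Finset.Ico 1 (N m + 1), twist l (S m) n / n) / Real.log (S m)) atTop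
      (𝓝 ((A * correlation (1 / A) l : ℝ) : ℂ)) := by
  have absorb : ∀ C ε : ℝ, 0 < ε → ∀ᶠ s : ℕ in atTop, C ≤ ε * Real.log s := fun C ε hε => by
    filter_upwards [tendsto_log_natCast_atTop.eventually_ge_atTop (C / ε)] with s hs
    rwa [div_le_iff₀' hε] at hs
  rcases moments_trichotomy l with h | h | ⟨k, hl, hk⟩
  · rw [correlation_of_forall h, mul_one]
    refine tendsto_div_log_of_eventually (fun _ N => Real.log N) (fun ε hε => ?_) hS hN
    -- As all moments vanish, any `k` is allowed; a large one makes the trivially bounded initial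
    -- stretch at most a small multiple of `log s`.
    obtain ⟨k, hk⟩ := exists_nat_gt (4 / ε)
    have hkε : 1 / ((k + 1 : ℕ) : ℝ) ≤ ε / 4 := by
      rw [div_le_iff₀ (by positivity)]
      rw [div_lt_iff₀ hε] at hk
      push_cast; nlinarith
    obtain ⟨C, hC⟩ := exists_norm_sum_twist_sub_max_le (l := l) (k := k) fun i _ => h i
    filter_upwards [hC, absorb (1 + C) (ε / 4) (by positivity), eventually_ge_atTop 1]
      with s hs hsC hs1 N
    have hlog := Real.log_natCast_nonneg s
    have h1 := hs (1 + Real.log s / (k + 1 : ℕ)) (fun b hb => by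
      rcases Nat.eq_zero_or_pos b with rfl | hb0
      · simp only [zero_le, Finset.Ico_eq_empty_of_le, Finset.sum_empty, norm_zero]; positivity
      · exact norm_sum_twist_le_one_add_log l hb0 le_rfl hb) N
    have h2 : ‖((max 0 (Real.log N - Real.log s / (k + 1 : ℕ)) : ℝ) : ℂ) - (Real.log N : ℝ)‖ ≤
        Real.log s / (k + 1 : ℕ) := by
      rw [← Complex.ofReal_sub, Complex.norm_real, Real.norm_eq_abs, abs_le]
      have h3 := Real.log_natCast_nonneg N
      have h4 : 0 ≤ Real.log s / (k + 1 : ℕ) := by positivity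
      rcases max_cases 0 (Real.log N - Real.log s / (k + 1 : ℕ)) with ⟨e, h⟩ | ⟨e, h⟩ <;>
        rw [e] <;> constructor <;> linarith
    have h3 : Real.log s / (k + 1 : ℕ) ≤ ε / 4 * Real.log s := by
      rw [div_eq_mul_one_div, mul_comm]; gcongr
    have h4 := norm_sub_le_norm_sub_add_norm_sub (∑ n ∈ Finset.Ico 1 (N + 1), twist l s n / n)
      ((max 0 (Real.log N - Real.log s / (k + 1 : ℕ)) : ℝ) : ℂ) (Real.log N : ℝ)
    linarith [mul_nonneg hε.le hlog]
  · rw [correlation_of_moment_zero_ne h, mul_zero]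
    refine tendsto_div_log_of_eventually (fun _ _ => 0) (fun ε hε => ?_) hS (by simp)
    -- For order `0` the constraint `b ^ 0 ≤ s` is void, so the bound holds for sums of any length.
    filter_upwards [eventually_norm_sum_twist_le_of_order (k := 0) (by simp) h hε,
      eventually_ge_atTop 1] with s hs hs1 N
    simpa using hs (N + 1) (by simpa using hs1)
  · rw [correlation_of_order hl hk]
    refine tendsto_div_log_of_eventually
      (fun s N => max 0 (Real.log N - Real.log s / (k + 1 : ℕ))) (fun ε hε => ?_) hS ?_
    · obtain ⟨C, hC⟩ := exists_norm_sum_twist_sub_max_le hl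
      filter_upwards [hC, eventually_norm_sum_twist_le_of_order hl hk (half_pos hε),
        absorb C (ε / 2) (by positivity)] with s hs hs' hsC N
      exact (hs _ hs' N).trans (by linarith)
    · have h1 : A * max 0 (1 - 1 / A / (k + 1 : ℕ)) = max 0 (A - 1 / (k + 1 : ℕ)) := by
        rw [mul_max_of_nonneg _ _ hA.le, mul_zero]
        congr 1
        field_simp
      rw [h1]
      refine (tendsto_const_nhds.max (hN.sub_const (1 / ((k + 1 : ℕ) : ℝ)))).congr' ?_
      filter_upwards [hS.eventually (tendsto_log_natCast_atTop.eventually_ge_atTop 1)] with m hm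
      have hpos : 0 < Real.log (S m) := by linarith
      rw [← max_div_div_right hpos.le, zero_div, sub_div, div_right_comm, div_self hpos.ne']

end SignedShifts

/-! ### Approximation of MRT functions by Archimedean characters -/

/-- Logarithmic sums of a bounded sequence on `ℤ` are almost invariant under shifts. -/
lemma abs_sum_Ico_shift_sub_le (e : ℤ → ℝ) {D : ℝ} (he : ∀ j, |e j| ≤ D) {b : ℕ} (hb : 1 ≤ b)
    (h : ℤ) :
    |∑ n ∈ Finset.Ico 1 b, e (n + h) / n - ∑ n ∈ Finset.Ico 1 b, e n / n| ≤ 2 * D * h.natAbs := by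
  have key : ∀ (v : ℤ) (k : ℕ), |∑ n ∈ Finset.Ico 1 b, e (n + (v + k)) / n -
      ∑ n ∈ Finset.Ico 1 b, e (n + v) / n| ≤ 2 * D * k := by
    intro v k
    have := norm_sum_Ico_add_div_sub_le (fun n : ℕ => ((e (n + v) : ℝ) : ℂ)) (D := D)
      (fun n => by rw [Complex.norm_real]; exact he _) le_rfl hb k
    rw [← Real.norm_eq_abs, ← Complex.norm_real]
    convert this using 2
    push_cast
    congr 1
    exact Finset.sum_congr rfl fun n _ => by rw [add_assoc, add_comm v]
  rcases Int.natAbs_eq h with h0 | h0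
  · have := key 0 h.natAbs
    simpa only [zero_add, ← h0, add_zero] using this
  · have := key h h.natAbs
    have e0 : h + h.natAbs = 0 := by omega
    rw [abs_sub_comm]
    simpa only [e0, add_zero] using this

lemma sum_filter_dvd_one_div_le (N : ℕ) {d : ℕ} (hd : 0 < d) :
    ∑ n ∈ Finset.Ico 1 (N + 1) with d ∣ n, (1 : ℝ) / n ≤ 1 / d * harmonic N := by
  have hsub : (Finset.Ico 1 (N + 1)).filter (d ∣ ·) ⊆ (Finset.Ico 1 (N + 1)).image (d * ·) := by
    intro n hn
    rw [Finset.mem_filter, Finset.mem_Ico] at hn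
    obtain ⟨⟨h1, h2⟩, m, rfl⟩ := hn
    refine Finset.mem_image.2 ⟨m, Finset.mem_Ico.2 ⟨?_, ?_⟩, rfl⟩
    · exact Nat.pos_of_mul_pos_left h1
    · exact lt_of_le_of_lt (Nat.le_mul_of_pos_left m hd) h2
  refine (Finset.sum_le_sum_of_subset_of_nonneg hsub fun _ _ _ => by positivity).trans ?_
  rw [Finset.sum_image fun x _ y _ h => Nat.eq_of_mul_eq_mul_left hd h,
    ← sum_Ico_one_div_eq_harmonic, Finset.mul_sum]
  refine Finset.sum_le_sum fun n _ => le_of_eq ?_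
  push_cast
  rw [one_div_mul_one_div]

/-- The valuation counts the `i ≥ 1` with `p ^ i ∣ n`. Multiples of `p ^ i` carry at most the
fraction `p ^ (-i) ≤ 2 ^ (-i)` of the logarithmic mass, and these fractions add up to at most `1`.
-/
lemma sum_factorization_div_le (N : ℕ) {p : ℕ} (hp : p.Prime) :
    ∑ n ∈ Finset.Ico 1 (N + 1), (n.factorization p : ℝ) / n ≤ harmonic N := by
  have h1 : ∀ n ∈ Finset.Ico 1 (N + 1), (n.factorization p : ℝ) / n ≤
      ∑ i ∈ Finset.Ico 1 (N + 1), if p ^ i ∣ n then (1 : ℝ) / n else 0 := by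
    intro n hn
    rw [Finset.mem_Ico] at hn
    rw [← Finset.sum_filter, Finset.sum_const, nsmul_eq_mul, mul_one_div,
      Nat.factorization_eq_card_pow_dvd n hp]
    gcongr
    omega
  refine (Finset.sum_le_sum h1).trans ?_
  rw [Finset.sum_comm]
  have h2 : ∀ i ∈ Finset.Ico 1 (N + 1), (∑ n ∈ Finset.Ico 1 (N + 1),
      if p ^ i ∣ n then (1 : ℝ) / n else 0) ≤ (1 / 2) ^ i * harmonic N := by
    intro i _
    rw [← Finset.sum_filter]
    refine (sum_filter_dvd_one_div_le N (pow_pos hp.pos i)).trans ?_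
    have hN : (0 : ℝ) ≤ harmonic N := by
      rw [← sum_Ico_one_div_eq_harmonic]; positivity
    gcongr
    rw [one_div_pow]
    push_cast
    gcongr
    exact_mod_cast hp.two_le
  refine (Finset.sum_le_sum h2).trans ?_
  rw [← Finset.sum_mul]
  have hN : (0 : ℝ) ≤ harmonic N := by
    rw [← sum_Ico_one_div_eq_harmonic]; positivity
  refine mul_le_of_le_one_left hN ?_
  have h3 : ∀ N : ℕ, ∑ i ∈ Finset.Ico 1 (N + 1), (1 / 2 : ℝ) ^ i = 1 - (1 / 2) ^ N := by
    intro N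
    induction N with
    | zero => simp
    | succ N ih => rw [Finset.sum_Ico_succ_top (by omega), ih]; ring
  rw [h3]
  have : (0 : ℝ) ≤ (1 / 2) ^ N := by positivity
  linarith

/-- The Archimedean character `j ↦ j ^ (i s)`. -/
noncomputable def archimedean (s : ℕ) (j : ℝ) : ℂ :=
  Complex.exp (Complex.I * ((s * Real.log j : ℝ) : ℂ))

lemma norm_archimedean (s : ℕ) (j : ℝ) : ‖archimedean s j‖ = 1 := by
  rw [archimedean, mul_comm, Complex.norm_exp_ofReal_mul_I]

lemma archimedean_mul (s : ℕ) {x y : ℝ} (hx : x ≠ 0) (hy : y ≠ 0) :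
    archimedean s (x * y) = archimedean s x * archimedean s y := by
  rw [archimedean, archimedean, archimedean, ← Complex.exp_add, Real.log_mul hx hy]
  push_cast
  ring_nf

lemma natCast_cpow_eq_archimedean (s p : ℕ) (hp : p ≠ 0) :
    (p : ℂ) ^ (Complex.I * (s : ℂ)) = archimedean s p := by
  rw [Complex.cpow_def_of_ne_zero (by exact_mod_cast hp), archimedean]
  push_cast
  ring_nf

lemma norm_mul_sub_mul_le {x y x' y' : ℂ} (hx : ‖x‖ ≤ 1) (hy' : ‖y'‖ ≤ 1) :
    ‖x * y - x' * y'‖ ≤ ‖x - x'‖ + ‖y - y'‖ := by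
  have e : x * y - x' * y' = x * (y - y') + (x - x') * y' := by ring
  rw [e]
  refine (norm_add_le _ _).trans ?_
  rw [norm_mul, norm_mul]
  nlinarith [norm_nonneg (x - x'), norm_nonneg (y - y')]

namespace IsMRTFunction

variable {f : ℕ+ →* Circle} {t s : ℕ → ℕ}

lemma one_le_t (hf : IsMRTFunction f t s) (m : ℕ) : 1 ≤ t m :=
  hf.t_zero.ge.trans (hf.strictMono_t.monotone (Nat.zero_le m))

/-- Both sides are completely multiplicative and unimodular, so errors add over prime factors with
multiplicity. Primes in `(t m, t (m + 1)]` contribute nothing and the smaller ones at most `1 / t m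
^ 2` each. -/
lemma norm_sub_archimedean_le (hf : IsMRTFunction f t s) (m : ℕ) (n : ℕ) :
    ∀ N : ℕ+, (N : ℕ) = n → n ≤ t (m + 1) → ‖(f N : ℂ) - archimedean (s (m + 1)) n‖ ≤
      1 / (t m : ℝ) ^ 2 * ∑ p ∈ Finset.Icc 1 (t m) with p.Prime, (n.factorization p : ℝ) := by
  induction n using Nat.recOnMul with
  | zero => intro N hN; exact absurd hN N.ne_zero
  | one =>
    intro N hN _
    rw [PNat.coe_eq_one_iff] at hN
    simp [hN, archimedean]
  | prime p hp =>
    intro N hN hpt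
    have hη : (0 : ℝ) ≤ 1 / (t m : ℝ) ^ 2 := by positivity
    rw [← natCast_cpow_eq_archimedean _ _ hp.ne_zero]
    subst hN
    rcases le_or_gt (N : ℕ) (t m) with h | h
    · refine (hf.approx_below m N hp h).trans (le_mul_of_one_le_right hη ?_)
      have : (((N : ℕ).factorization N : ℕ) : ℝ) = 1 := by simp [hp.factorization]
      rw [← this]
      exact Finset.single_le_sum (f := fun q => ((N : ℕ).factorization q : ℝ))
        (fun _ _ => Nat.cast_nonneg _)
        (Finset.mem_filter.2 ⟨Finset.mem_Icc.2 ⟨N.pos, h⟩, hp⟩)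
    · rw [hf.eq_on_interval m N hp h hpt, sub_self, norm_zero]
      exact mul_nonneg hη (Finset.sum_nonneg fun _ _ => Nat.cast_nonneg _)
  | mul a b iha ihb =>
    intro N hN hab
    have hn : 0 < a * b := hN ▸ N.pos
    have ha : 0 < a := Nat.pos_of_mul_pos_right hn
    have hb : 0 < b := Nat.pos_of_mul_pos_left hn
    obtain ⟨A, rfl⟩ : ∃ A : ℕ+, (A : ℕ) = a := ⟨⟨a, ha⟩, rfl⟩
    obtain ⟨B, rfl⟩ : ∃ B : ℕ+, (B : ℕ) = b := ⟨⟨b, hb⟩, rfl⟩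
    have e : N = A * B := PNat.eq (by rw [hN, PNat.mul_coe])
    have h1 := iha A rfl ((Nat.le_mul_of_pos_right _ hb).trans hab)
    have h2 := ihb B rfl ((Nat.le_mul_of_pos_left _ ha).trans hab)
    rw [e, map_mul, Nat.cast_mul, archimedean_mul _ (by positivity) (by positivity),
      Circle.coe_mul]
    refine (norm_mul_sub_mul_le (Circle.norm_coe _).le (norm_archimedean _ _).le).trans ?_
    refine (add_le_add h1 h2).trans (le_of_eq ?_)
    rw [← mul_add, ← Finset.sum_add_distrib, Nat.factorization_mul ha.ne' hb.ne']
    simp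

/-- Each of the at most `t m` small primes has logarithmic average valuation at most `1`, so the
total error is `t m * (1 / t m ^ 2) = 1 / t m` on average. -/
lemma sum_norm_sub_archimedean_le (hf : IsMRTFunction f t s) {a : SeqSpace}
    (ha : ∀ n : ℕ+, (a ((n : ℕ) : ℤ) : ℂ) = (f n : ℂ)) (m : ℕ) {N : ℕ} (hN : N ≤ t (m + 1)) :
    ∑ n ∈ Finset.Ico 1 (N + 1), ‖(a (n : ℤ) : ℂ) - archimedean (s (m + 1)) n‖ / n ≤
      harmonic N / t m := by
  have ht : (1 : ℝ) ≤ t m := by exact_mod_cast hf.one_le_t m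
  have hN0 : (0 : ℝ) ≤ harmonic N := by
    rw [← sum_Ico_one_div_eq_harmonic]; positivity
  calc _ ≤ ∑ n ∈ Finset.Ico 1 (N + 1), ∑ p ∈ Finset.Icc 1 (t m) with p.Prime,
        1 / (t m : ℝ) ^ 2 * ((n.factorization p : ℝ) / n) := by
        refine Finset.sum_le_sum fun n hn => ?_
        rw [Finset.mem_Ico] at hn
        obtain ⟨k, rfl⟩ : ∃ k : ℕ+, (k : ℕ) = n := ⟨⟨n, hn.1⟩, rfl⟩
        have := hf.norm_sub_archimedean_le m k k rfl (by omega)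
        rw [← ha] at this
        rw [← Finset.mul_sum, ← Finset.sum_div, ← mul_div_assoc]
        gcongr
    _ = 1 / (t m : ℝ) ^ 2 * ∑ p ∈ Finset.Icc 1 (t m) with p.Prime,
        ∑ n ∈ Finset.Ico 1 (N + 1), (n.factorization p : ℝ) / n := by
        rw [Finset.sum_comm, Finset.mul_sum]
        simp only [Finset.mul_sum]
    _ ≤ 1 / (t m : ℝ) ^ 2 * ∑ p ∈ Finset.Icc 1 (t m) with p.Prime, (harmonic N : ℝ) := by
        gcongr with p hp
        exact sum_factorization_div_le N (Finset.mem_filter.1 hp).2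
    _ ≤ 1 / (t m : ℝ) ^ 2 * (t m * harmonic N) := by
        rw [Finset.sum_const, nsmul_eq_mul]
        gcongr
        refine (Finset.card_filter_le _ _).trans ?_
        simp
    _ = _ := by field_simp

end IsMRTFunction

/-! ### Monomials in the coordinates -/

/-- The coordinate at `q.1`, conjugated if the sign `q.2` is not `1`. -/
noncomputable def signedCoord (q : ℤ × ℤˣ) : C(SeqSpace, ℂ) :=
  if q.2 = 1 then ⟨fun x => (x q.1 : ℂ), by fun_prop⟩ else star ⟨fun x => (x q.1 : ℂ), by fun_prop⟩

/-- The product of signed coordinates. -/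
noncomputable def coordMonomial (l : SignedShifts) : C(SeqSpace, ℂ) := (l.map signedCoord).prod

lemma signedCoord_apply (q : ℤ × ℤˣ) (x : SeqSpace) :
    signedCoord q x = if q.2 = 1 then (x q.1 : ℂ) else starRingEnd ℂ (x q.1 : ℂ) := by
  rw [signedCoord]
  split_ifs <;> rfl

lemma coordMonomial_nil : coordMonomial [] = 1 := rfl

lemma coordMonomial_cons (q : ℤ × ℤˣ) (l : SignedShifts) (x : SeqSpace) :
    coordMonomial (q :: l) x = signedCoord q x * coordMonomial l x := by
  simp [coordMonomial]

lemma coordMonomial_append (l l' : SignedShifts) :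
    coordMonomial (l ++ l') = coordMonomial l * coordMonomial l' := by
  simp [coordMonomial]

lemma norm_signedCoord_le (q : ℤ × ℤˣ) (x : SeqSpace) : ‖signedCoord q x‖ ≤ 1 := by
  have : ‖(x q.1 : ℂ)‖ ≤ 1 := mem_closedBall_zero_iff.1 (x q.1).2
  rw [signedCoord_apply]
  split_ifs
  · exact this
  · rwa [RCLike.norm_conj]

lemma norm_coordMonomial_le (l : SignedShifts) (x : SeqSpace) : ‖coordMonomial l x‖ ≤ 1 := by
  induction l with
  | nil => simp [coordMonomial]
  | cons q l ih =>
    rw [coordMonomial_cons, norm_mul]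
    exact mul_le_one₀ (norm_signedCoord_le q x) (norm_nonneg _) ih

lemma coordMonomial_shiftPow (l : SignedShifts) (n : ℤ) (x : SeqSpace) :
    coordMonomial l (shiftPow n x) = coordMonomial (SignedShifts.translate n l) x := by
  induction l with
  | nil => rfl
  | cons q l ih =>
    have : SignedShifts.translate n (q :: l) = (q.1 + n, q.2) :: SignedShifts.translate n l := rfl
    rw [this, coordMonomial_cons, coordMonomial_cons, ih, signedCoord_apply, signedCoord_apply]
    rfl

lemma coordMonomial_opposite (l : SignedShifts) (x : SeqSpace) :
    coordMonomial (SignedShifts.opposite l) x = starRingEnd ℂ (coordMonomial l x) := by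
  induction l with
  | nil => simp [SignedShifts.opposite, coordMonomial]
  | cons q l ih =>
    have : SignedShifts.opposite (q :: l) = (q.1, -q.2) :: (SignedShifts.opposite l) := rfl
    rw [this, coordMonomial_cons, coordMonomial_cons, ih, map_mul, signedCoord_apply,
      signedCoord_apply]
    rcases Int.units_eq_one_or q.2 with h | h <;> simp [h]

lemma norm_coordMonomial_sub_twist_le (l : SignedShifts) (s n : ℕ) (a : SeqSpace) :
    ‖coordMonomial l (shiftPow n a) - SignedShifts.twist l s n‖ ≤
      (l.map fun q => ‖(a (n + q.1) : ℂ) - archimedean s ((n + q.1 : ℤ) : ℝ)‖).sum := by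
  induction l with
  | nil => simp [coordMonomial, SignedShifts.twist, SignedShifts.logPhase]
  | cons q l ih =>
    have e : SignedShifts.twist (q :: l) s n =
        (if q.2 = 1 then archimedean s ((n + q.1 : ℤ) : ℝ)
          else starRingEnd ℂ (archimedean s ((n + q.1 : ℤ) : ℝ))) * SignedShifts.twist l s n := by
      rcases Int.units_eq_one_or q.2 with h | h
      · simp only [h, if_true, SignedShifts.twist, SignedShifts.logPhase_cons, archimedean,
          ← Complex.exp_add]
        congr 1; push_cast; ring
      · have h1 : (-1 : ℤˣ) ≠ 1 := by decide
        simp only [h, if_neg h1, SignedShifts.twist, SignedShifts.logPhase_cons, archimedean,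
          ← Complex.exp_conj, ← Complex.exp_add, map_mul, Complex.conj_I, Complex.conj_ofReal]
        congr 1; push_cast; ring
    rw [coordMonomial_cons, e, List.map_cons, List.sum_cons]
    refine (norm_mul_sub_mul_le (norm_signedCoord_le _ _) (SignedShifts.norm_twist _ _ _).le).trans
      (add_le_add (le_of_eq ?_) ih)
    rw [signedCoord_apply]
    have : shiftPow n a q.1 = a (n + q.1) := by rw [shiftPow, add_comm]
    rw [this]
    split_ifs
    · rfl
    · rw [← map_sub, RCLike.norm_conj]

/-- The error of a product of unimodularly bounded factors is at most the sum of the errors of the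
factors. Each is a shifted copy of the error of `f`, and undoing the shift by `h` costs at most `4
|h|`. Thus `C` depends on neither `m` nor `N`. -/
lemma IsMRTFunction.exists_norm_sum_sub_twist_le {f : ℕ+ →* Circle} {t s : ℕ → ℕ}
    (hf : IsMRTFunction f t s) {a : SeqSpace}
    (ha : ∀ n : ℕ+, (a ((n : ℕ) : ℤ) : ℂ) = (f n : ℂ)) (l : SignedShifts) :
    ∃ C : ℝ, ∀ m N : ℕ, N ≤ t (m + 1) →
      ‖∑ n ∈ Finset.Ico 1 (N + 1), coordMonomial l (shiftPow n a) / n -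
        ∑ n ∈ Finset.Ico 1 (N + 1), l.twist (s (m + 1)) n / n‖ ≤
        C + l.length * (harmonic N / t m) := by
  suffices H : ∃ C : ℝ, ∀ m N : ℕ, N ≤ t (m + 1) → ∑ n ∈ Finset.Ico 1 (N + 1),
      (l.map fun q => ‖(a (n + q.1) : ℂ) - archimedean (s (m + 1)) ((n + q.1 : ℤ) : ℝ)‖).sum / n ≤
        C + l.length * (harmonic N / t m) by
    obtain ⟨C, hC⟩ := H
    refine ⟨C, fun m N hN => le_trans ?_ (hC m N hN)⟩
    rw [← Finset.sum_sub_distrib]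
    refine (norm_sum_le _ _).trans (Finset.sum_le_sum fun n _ => ?_)
    rw [← sub_div, norm_div, Complex.norm_natCast]
    gcongr
    exact norm_coordMonomial_sub_twist_le l _ n a
  induction l with
  | nil => exact ⟨0, fun m N _ => by simp⟩
  | cons q l ih =>
    obtain ⟨C, hC⟩ := ih
    refine ⟨4 * q.1.natAbs + C, fun m N hN => ?_⟩
    have h1 := hC m N hN
    -- This holds at nonpositive `j` too, where `a` is arbitrary and `Real.log` takes conventional
    -- values: `archimedean` is always unimodular.
    have hbd : ∀ j : ℤ, |‖(a j : ℂ) - archimedean (s (m + 1)) (j : ℝ)‖| ≤ 2 := fun j => by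
      rw [abs_norm]
      refine (norm_sub_le _ _).trans ?_
      rw [norm_archimedean]
      have : ‖(a j : ℂ)‖ ≤ 1 := mem_closedBall_zero_iff.1 (a j).2
      linarith
    have h2 := abs_sum_Ico_shift_sub_le (fun j => ‖(a j : ℂ) - archimedean (s (m + 1)) (j : ℝ)‖)
      hbd (Nat.succ_le_succ (Nat.zero_le N)) q.1
    have h3 := hf.sum_norm_sub_archimedean_le ha m hN
    simp only [List.map_cons, List.sum_cons, add_div, Finset.sum_add_distrib, List.length_cons]
    push_cast at h2 h1 ⊢
    have := (abs_le.1 h2).2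
    simp only [Nat.succ_eq_add_one] at this
    linarith

/-! ### Convergence of the logarithmic averages of monomials -/

lemma tendsto_log_floor_div {α : Type*} {F : Filter α} {u v : α → ℝ} {A : ℝ}
    (hu : Tendsto u F atTop) (hv : Tendsto v F atTop)
    (h : Tendsto (fun m => Real.log (u m) / v m) F (𝓝 A)) :
    Tendsto (fun m => Real.log ⌊u m⌋₊ / v m) F (𝓝 A) := by
  have h1 : Tendsto (fun m => Real.log (u m) / v m - Real.log 2 / v m) F (𝓝 (A - 0)) :=
    h.sub (hv.const_div_atTop _)
  rw [sub_zero] at h1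
  refine tendsto_of_tendsto_of_tendsto_of_le_of_le' h1 h ?_ ?_
  · filter_upwards [hu.eventually_ge_atTop 1, hv.eventually_gt_atTop 0] with m hm hvm
    have h2 : (1 : ℝ) ≤ ⌊u m⌋₊ := by exact_mod_cast Nat.le_floor (by simpa using hm)
    rw [← sub_div, ← Real.log_div (by linarith) (by norm_num)]
    gcongr
    linarith [Nat.lt_floor_add_one (u m)]
  · filter_upwards [hu.eventually_ge_atTop 1, hv.eventually_gt_atTop 0] with m hm hvm
    have h2 : (1 : ℝ) ≤ ⌊u m⌋₊ := by exact_mod_cast Nat.le_floor (by simpa using hm)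
    gcongr
    exact Nat.floor_le (by linarith)

lemma sum_Ico_sub_sum_Ico_div_norm_le {u : ℕ → ℂ} (hu : ∀ n, ‖u n‖ ≤ 1) {N P : ℕ} (h : N ≤ P) :
    ‖∑ n ∈ Finset.Ico 1 (P + 1), u n / n - ∑ n ∈ Finset.Ico 1 (N + 1), u n / n‖ ≤
      harmonic P - harmonic N := by
  have h1 : 1 ≤ N + 1 := by omega
  have h2 : N + 1 ≤ P + 1 := by omega
  rw [← Finset.sum_Ico_consecutive (fun n => u n / n) h1 h2, add_sub_cancel_left,
    ← sum_Ico_one_div_eq_harmonic, ← sum_Ico_one_div_eq_harmonic,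
    ← Finset.sum_Ico_consecutive (fun n : ℕ => (1 : ℝ) / n) h1 h2, add_sub_cancel_left]
  refine (norm_sum_le _ _).trans (Finset.sum_le_sum fun n _ => ?_)
  rw [norm_div, Complex.norm_natCast]
  gcongr
  exact hu n

lemma tendsto_harmonic_div {α : Type*} {F : Filter α} {N : α → ℕ} {v : α → ℝ} {A : ℝ}
    (hv : Tendsto v F atTop) (h : Tendsto (fun m => Real.log (N m) / v m) F (𝓝 A)) :
    Tendsto (fun m => (harmonic (N m) : ℝ) / v m) F (𝓝 A) := by
  have h0 : Tendsto (fun m => ((harmonic (N m) : ℝ) - Real.log (N m)) / v m) F (𝓝 0) := by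
    refine squeeze_zero_norm' ?_ (hv.const_div_atTop 1)
    filter_upwards [hv.eventually_gt_atTop 0] with m hm
    rw [norm_div, Real.norm_eq_abs, Real.norm_eq_abs, abs_of_pos hm]
    gcongr
    exact abs_harmonic_sub_log_le _
  simpa [← add_div] using h0.add h

namespace IsMRTFunction

variable {f : ℕ+ →* Circle} {t s : ℕ → ℕ}

lemma tendsto_s (hf : IsMRTFunction f t s) : Tendsto (fun m => s (m + 1)) atTop atTop :=
  hf.strictMono_s.tendsto_atTop.comp (tendsto_add_atTop_nat 1)

lemma tendsto_log_s (hf : IsMRTFunction f t s) :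
    Tendsto (fun m => Real.log (s (m + 1))) atTop atTop :=
  tendsto_log_natCast_atTop.comp hf.tendsto_s

/-- The truncation of `[L]` to the range in which `f` is close to an Archimedean character does
not change the fractional degree. -/
lemma tendsto_log_min_div (hf : IsMRTFunction f t s) {c : ℝ} (hc : 0 < c) {L : ℕ → ℝ}
    (hL : HasFractionalDegree L (1 / c))
    (ht : c < 1 / 2 → ∀ᶠ m in atTop, L (s (m + 1)) ≤ (t (m + 1) : ℝ)) :
    Tendsto (fun m => Real.log (min ⌊L (s (m + 1))⌋₊ (t (m + 1)) : ℕ) / Real.log (s (m + 1)))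
      atTop (𝓝 (1 / c)) := by
  have hP : Tendsto (fun m => Real.log ⌊L (s (m + 1))⌋₊ / Real.log (s (m + 1))) atTop
      (𝓝 (1 / c)) :=
    tendsto_log_floor_div (hL.2.1.comp hf.tendsto_s) hf.tendsto_log_s (hL.2.2.comp hf.tendsto_s)
  rcases lt_or_ge c (1 / 2) with hc2 | hc2
  · refine hP.congr' ?_
    filter_upwards [ht hc2] with m hm
    rw [min_eq_left (Nat.floor_le_of_le hm)]
  -- Here `1 / c ≤ 2`, and `s (m + 1) ^ 2 ≤ t (m + 1)`: cutting at `t (m + 1)` cannot bring the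
  -- exponent below `min (1 / c) 2 = 1 / c`.
  · have h1 : Tendsto (fun m => min (Real.log ⌊L (s (m + 1))⌋₊ / Real.log (s (m + 1))) 2) atTop
        (𝓝 (min (1 / c) 2)) := hP.min tendsto_const_nhds
    rw [min_eq_left (by rw [div_le_iff₀ hc]; linarith)] at h1
    refine tendsto_of_tendsto_of_tendsto_of_le_of_le' h1 hP ?_ ?_
    · filter_upwards [hf.tendsto_log_s.eventually_gt_atTop 0] with m hm
      rcases min_cases ⌊L (s (m + 1))⌋₊ (t (m + 1)) with ⟨h, _⟩ | ⟨h, _⟩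
      · rw [h]; exact min_le_left _ _
      · rw [h]
        refine (min_le_right _ _).trans ?_
        have hs : 0 < s (m + 1) := lt_of_le_of_lt (Nat.zero_le _) (hf.growth m).1
        rw [le_div_iff₀ hm]
        have := Real.log_le_log (by positivity)
          (by exact_mod_cast (hf.growth m).2.2 : ((s (m + 1) : ℝ)) ^ 2 ≤ t (m + 1))
        rwa [Real.log_pow, Nat.cast_ofNat] at this
    · filter_upwards [hf.tendsto_log_s.eventually_gt_atTop 0,
        (hL.2.1.comp hf.tendsto_s).eventually_ge_atTop 1] with m hm hLm
      have h2 : 1 ≤ ⌊L (s (m + 1))⌋₊ := Nat.le_floor (by simpa using hLm)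
      have h3 := hf.one_le_t (m + 1)
      gcongr
      exact min_le_left _ _

/-- Two errors are `o(log s)`: shortening the sum from `P m` to `N m`, as both have the same
exponent, and replacing `f` by the character. The twist asymptotics supply the main term, and the
normalising harmonic sum is asymptotic to `log s / c`. -/
theorem tendsto_logAverage_coordMonomial (hf : IsMRTFunction f t s) {a : SeqSpace}
    (ha : ∀ n : ℕ+, (a ((n : ℕ) : ℤ) : ℂ) = (f n : ℂ)) {c : ℝ} (hc : 0 < c) {L : ℕ → ℝ}
    (hL : HasFractionalDegree L (1 / c))
    (ht : c < 1 / 2 → ∀ᶠ m in atTop, L (s (m + 1)) ≤ (t (m + 1) : ℝ)) (l : SignedShifts) :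
    Tendsto (fun m => logAverage (L (s (m + 1))) fun n => coordMonomial l (shiftPow n a)) atTop
      (𝓝 ((SignedShifts.correlation c l : ℝ) : ℂ)) := by
  set v : ℕ → ℝ := fun m => Real.log (s (m + 1)) with hv
  set P : ℕ → ℕ := fun m => ⌊L (s (m + 1))⌋₊ with hPdef
  set N : ℕ → ℕ := fun m => min ⌊L (s (m + 1))⌋₊ (t (m + 1)) with hNdef
  have hvt : Tendsto v atTop atTop := hf.tendsto_log_s
  have hP : Tendsto (fun m => Real.log (P m) / v m) atTop (𝓝 (1 / c)) :=
    tendsto_log_floor_div (hL.2.1.comp hf.tendsto_s) hf.tendsto_log_s (hL.2.2.comp hf.tendsto_s)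
  have hN : Tendsto (fun m => Real.log (N m) / v m) atTop (𝓝 (1 / c)) :=
    hf.tendsto_log_min_div hc hL ht
  have hHP := tendsto_harmonic_div hvt hP
  have hHN := tendsto_harmonic_div hvt hN
  have hc' : 0 < 1 / c := by positivity
  have h1 := SignedShifts.tendsto_sum_twist l hf.tendsto_s hc' hN
  rw [one_div_one_div] at h1
  obtain ⟨C, hC⟩ := hf.exists_norm_sum_sub_twist_le ha l
  have htm : Tendsto (fun m => 1 / (t m : ℝ)) atTop (𝓝 0) :=
    tendsto_const_nhds.div_atTop
      (tendsto_natCast_atTop_atTop.comp hf.strictMono_t.tendsto_atTop)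
  have h2 : Tendsto (fun m => (∑ n ∈ Finset.Ico 1 (N m + 1), coordMonomial l (shiftPow n a) / n -
      ∑ n ∈ Finset.Ico 1 (N m + 1), SignedShifts.twist l (s (m + 1)) n / n) / (v m : ℂ)) atTop
      (𝓝 0) := by
    have hlim : Tendsto (fun m => C / v m + l.length * ((harmonic (N m) : ℝ) / v m * (1 / t m)))
        atTop (𝓝 (0 + l.length * (1 / c * 0))) :=
      (hvt.const_div_atTop C).add ((hHN.mul htm).const_mul _)
    rw [mul_zero, mul_zero, add_zero] at hlim
    refine squeeze_zero_norm' ?_ hlim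
    filter_upwards [hvt.eventually_gt_atTop 0] with m hm
    rw [norm_div, Complex.norm_real, Real.norm_eq_abs, abs_of_pos hm]
    refine (div_le_div_of_nonneg_right (hC m (N m) (min_le_right _ _)) hm.le).trans (le_of_eq ?_)
    ring
  have h3 : Tendsto (fun m => (∑ n ∈ Finset.Ico 1 (P m + 1), coordMonomial l (shiftPow n a) / n -
      ∑ n ∈ Finset.Ico 1 (N m + 1), coordMonomial l (shiftPow n a) / n) / (v m : ℂ)) atTop
      (𝓝 0) := by
    have hlim := hHP.sub hHN
    rw [sub_self] at hlim
    refine squeeze_zero_norm' ?_ hlim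
    filter_upwards [hvt.eventually_gt_atTop 0] with m hm
    rw [norm_div, Complex.norm_real, Real.norm_eq_abs, abs_of_pos hm, ← sub_div]
    gcongr
    exact sum_Ico_sub_sum_Ico_div_norm_le (fun n => norm_coordMonomial_le _ _) (min_le_left _ _)
  have h4 := (h3.add h2).add h1
  have h5 := (Complex.continuous_ofReal.tendsto _).comp hHP
  have h6 := h4.div h5 (by exact_mod_cast hc'.ne')
  have e : (0 + 0 + ((1 / c * SignedShifts.correlation c l : ℝ) : ℂ)) / ((1 / c : ℝ) : ℂ) =
      ((SignedShifts.correlation c l : ℝ) : ℂ) := by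
    rw [zero_add, zero_add, Complex.ofReal_mul, mul_div_cancel_left₀ _ (by exact_mod_cast hc'.ne')]
  rw [e] at h6
  refine h6.congr' ?_
  filter_upwards [hvt.eventually_gt_atTop 0] with m hm
  have hm' : (v m : ℂ) ≠ 0 := by exact_mod_cast hm.ne'
  simp only [Pi.div_apply, Function.comp_apply]
  rw [← add_div, ← add_div, sub_add_sub_cancel, sub_add_cancel, Complex.ofReal_div,
    div_div_div_cancel_right₀ hm', logAverage, ← sum_Ico_one_div_eq_harmonic]
  push_cast
  rfl

end IsMRTFunction

/-! ### Density of the monomials -/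

lemma coordMonomial_injOn_points {x y : SeqSpace} (h : ∀ l, coordMonomial l x = coordMonomial l y) :
    x = y := by
  funext j
  have := h [(j, 1)]
  rw [coordMonomial_cons, coordMonomial_cons, coordMonomial_nil, signedCoord_apply,
    signedCoord_apply] at this
  exact Subtype.ext (by simpa using this)

/-- Stone–Weierstrass: concatenating lists multiplies monomials, changing all signs conjugates them,
and single coordinates separate points. -/
lemma dense_span_coordMonomial :
    Dense (Submodule.span ℂ (Set.range coordMonomial) : Set C(SeqSpace, ℂ)) := by
  have hmem : ∀ l, coordMonomial l ∈ Submodule.span ℂ (Set.range coordMonomial) :=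
    fun l => Submodule.subset_span ⟨l, rfl⟩
  have hstar : ∀ l, star (coordMonomial l) = coordMonomial (SignedShifts.opposite l) := fun l =>
    ContinuousMap.ext fun x => (coordMonomial_opposite l x).symm
  have hmul : ∀ F G, F ∈ Submodule.span ℂ (Set.range coordMonomial) →
      G ∈ Submodule.span ℂ (Set.range coordMonomial) →
      F * G ∈ Submodule.span ℂ (Set.range coordMonomial) := by
    intro F G hF hG
    induction hF, hG using Submodule.span_induction₂ with
    | mem_mem x y hx hy =>
      obtain ⟨l, rfl⟩ := hx
      obtain ⟨l', rfl⟩ := hy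
      rw [← coordMonomial_append]; exact hmem _
    | zero_left => simp
    | zero_right => simp
    | add_left x y z _ _ _ h1 h2 => rw [add_mul]; exact Submodule.add_mem _ h1 h2
    | add_right x y z _ _ _ h1 h2 => rw [mul_add]; exact Submodule.add_mem _ h1 h2
    | smul_left r x y _ _ h => rw [smul_mul_assoc]; exact Submodule.smul_mem _ _ h
    | smul_right r x y _ _ h => rw [mul_smul_comm]; exact Submodule.smul_mem _ _ h
  let A : StarSubalgebra ℂ C(SeqSpace, ℂ) :=
    { carrier := Submodule.span ℂ (Set.range coordMonomial)
      mul_mem' := fun {F G} hF hG => hmul F G hF hG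
      add_mem' := fun {F G} hF hG => Submodule.add_mem _ hF hG
      algebraMap_mem' := fun r => by
        rw [Algebra.algebraMap_eq_smul_one, ← coordMonomial_nil]
        exact Submodule.smul_mem _ _ (hmem _)
      star_mem' := fun {F} hF => by
        induction hF using Submodule.span_induction with
        | mem x hx =>
          obtain ⟨l, rfl⟩ := hx
          rw [hstar]; exact hmem _
        | zero => rw [star_zero]; exact Submodule.zero_mem _
        | add x y _ _ h1 h2 => rw [star_add]; exact Submodule.add_mem _ h1 h2
        | smul r x _ h => rw [star_smul]; exact Submodule.smul_mem _ _ h }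
  have hA : A.topologicalClosure = ⊤ := by
    refine ContinuousMap.starSubalgebra_topologicalClosure_eq_top_of_separatesPoints A ?_
    intro x y hxy
    by_contra! hcon
    exact hxy (coordMonomial_injOn_points fun l => hcon _ ⟨coordMonomial l, hmem l, rfl⟩)
  intro F
  have : F ∈ A.topologicalClosure := hA ▸ StarSubalgebra.mem_top
  exact this

lemma coordMonomial_induction {p : C(SeqSpace, ℂ) → Prop} (monomial : ∀ l, p (coordMonomial l))
    (add : ∀ F G, p F → p G → p (F + G)) (smul : ∀ (r : ℂ) F, p F → p (r • F))
    (closed : ∀ F, (∀ ε : ℝ, 0 < ε → ∃ G, p G ∧ ‖F - G‖ ≤ ε) → p F) (F : C(SeqSpace, ℂ)) : p F := by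
  refine closed F fun ε hε => ?_
  obtain ⟨G, hG, hd⟩ := Metric.mem_closure_iff.1 (dense_span_coordMonomial F) ε hε
  refine ⟨G, ?_, by rw [← dist_eq_norm]; exact hd.le⟩
  clear hd
  change G ∈ Submodule.span ℂ (Set.range coordMonomial) at hG
  induction hG using Submodule.span_induction with
  | mem x hx => obtain ⟨l, rfl⟩ := hx; exact monomial l
  | zero => simpa using smul 0 _ (monomial [])
  | add x y _ _ h1 h2 =>
    exact add x y h1 h2
  | smul r x _ h => exact smul r x h

lemma integrable_continuousMap (μ : Measure SeqSpace) [IsFiniteMeasure μ] (F : C(SeqSpace, ℂ)) :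
    Integrable F μ :=
  F.continuous.integrable_of_hasCompactSupport (HasCompactSupport.of_compactSpace _)

lemma norm_integral_sub_integral_le (μ : Measure SeqSpace) [IsFiniteMeasure μ]
    (F G : C(SeqSpace, ℂ)) :
    ‖∫ x, F x ∂μ - ∫ x, G x ∂μ‖ ≤ ‖F - G‖ * μ.real Set.univ := by
  rw [← integral_sub (integrable_continuousMap μ F) (integrable_continuousMap μ G)]
  exact norm_integral_le_of_norm_le_const (Eventually.of_forall fun x => (F - G).norm_coe_le_norm x)

/-- Two finite measures on the sequence space with the same integrals of monomials agree. -/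
lemma ext_of_integral_coordMonomial {μ ν : Measure SeqSpace} [IsFiniteMeasure μ]
    [IsFiniteMeasure ν] (h : ∀ l, ∫ x, coordMonomial l x ∂μ = ∫ x, coordMonomial l x ∂ν) :
    μ = ν := by
  have key : ∀ F : C(SeqSpace, ℂ), ∫ x, F x ∂μ = ∫ x, F x ∂ν := by
    refine coordMonomial_induction h (fun F G hF hG => ?_) (fun r F hF => ?_) fun F hF => ?_
    · simp only [ContinuousMap.add_apply]
      rw [integral_add (integrable_continuousMap μ F) (integrable_continuousMap μ G),
        integral_add (integrable_continuousMap ν F) (integrable_continuousMap ν G), hF, hG]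
    · simp only [ContinuousMap.smul_apply, integral_smul, hF]
    · rw [← sub_eq_zero, ← norm_le_zero_iff]
      refine le_of_forall_pos_le_add fun ε hε => ?_
      have hpos : 0 < μ.real Set.univ + ν.real Set.univ + 1 := by positivity
      obtain ⟨G, hG, hd⟩ := hF (ε / (μ.real Set.univ + ν.real Set.univ + 1)) (by positivity)
      have h1 := norm_integral_sub_integral_le μ F G
      have h2 := norm_integral_sub_integral_le ν F G
      rw [norm_sub_rev] at h2
      have h3 := norm_add_le (∫ x, F x ∂μ - ∫ x, G x ∂μ) (∫ x, G x ∂ν - ∫ x, F x ∂ν)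
      rw [hG, sub_add_sub_cancel] at h3
      rw [hG] at h1
      rw [le_div_iff₀ hpos] at hd
      nlinarith [norm_nonneg (F - G)]
  refine ext_of_forall_integral_eq_of_IsFiniteMeasure fun g => ?_
  have := key ⟨fun x => ((g x : ℝ) : ℂ), by fun_prop⟩
  simp only [ContinuousMap.coe_mk] at this
  rw [integral_complex_ofReal, integral_complex_ofReal] at this
  exact_mod_cast this

lemma norm_logAverage_sub_le {M C : ℝ} {u v : ℕ → ℂ} (h : ∀ n, ‖u n - v n‖ ≤ C) :
    ‖logAverage M u - logAverage M v‖ ≤ C := by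
  have hC : 0 ≤ C := (norm_nonneg _).trans (h 0)
  have hH : ∑ n ∈ Finset.Icc 1 ⌊M⌋₊, 1 / (n : ℂ) =
      ((∑ n ∈ Finset.Icc 1 ⌊M⌋₊, 1 / (n : ℝ) : ℝ) : ℂ) := by push_cast; rfl
  rw [logAverage, logAverage, ← sub_div, ← Finset.sum_sub_distrib, norm_div, hH, Complex.norm_real,
    Real.norm_eq_abs, abs_of_nonneg (by positivity)]
  refine div_le_of_le_mul₀ (by positivity) hC ?_
  rw [Finset.mul_sum]
  refine (norm_sum_le _ _).trans (Finset.sum_le_sum fun n _ => ?_)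
  rw [← sub_div, norm_div, Complex.norm_natCast, mul_one_div]
  gcongr
  exact h n

lemma tendsto_logAverage_of_coordMonomial {a : SeqSpace} {M : ℕ → ℝ} {μ : Measure SeqSpace}
    [IsProbabilityMeasure μ]
    (h : ∀ l, Tendsto (fun m => logAverage (M m) fun n => coordMonomial l (shiftPow n a)) atTop
      (𝓝 (∫ x, coordMonomial l x ∂μ))) (F : C(SeqSpace, ℂ)) :
    Tendsto (fun m => logAverage (M m) fun n => F (shiftPow n a)) atTop (𝓝 (∫ x, F x ∂μ)) := by
  refine coordMonomial_induction (p := fun F => Tendsto (fun m => logAverage (M m)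
    fun n => F (shiftPow n a)) atTop (𝓝 (∫ x, F x ∂μ))) h (fun F G hF hG => ?_)
    (fun r F hF => ?_) (fun F hF => ?_) F
  · simp only [ContinuousMap.add_apply]
    rw [integral_add (integrable_continuousMap μ F) (integrable_continuousMap μ G)]
    refine (hF.add hG).congr fun m => ?_
    simp only [logAverage, add_div, Finset.sum_add_distrib]
  · simp only [ContinuousMap.smul_apply, integral_smul]
    refine (hF.const_smul r).congr fun m => ?_
    simp only [logAverage, smul_eq_mul, mul_div_assoc, Finset.mul_sum, Finset.sum_div]
  · rw [Metric.tendsto_nhds]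
    intro ε hε
    obtain ⟨G, hG, hd⟩ := hF (ε / 3) (by positivity)
    filter_upwards [Metric.tendsto_nhds.1 hG (ε / 3) (by positivity)] with m hm
    have h1 : ‖logAverage (M m) (fun n => F (shiftPow n a)) -
        logAverage (M m) (fun n => G (shiftPow n a))‖ ≤ ε / 3 :=
      norm_logAverage_sub_le fun n => ((F - G).norm_coe_le_norm _).trans hd
    have h2 := norm_integral_sub_integral_le μ F G
    rw [probReal_univ, mul_one, norm_sub_rev] at h2
    rw [dist_eq_norm] at hm ⊢
    have h3 := norm_add₃_le
      (a := logAverage (M m) (fun n => F (shiftPow n a)) -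
        logAverage (M m) (fun n => G (shiftPow n a)))
      (b := logAverage (M m) (fun n => G (shiftPow n a)) - ∫ x, G x ∂μ)
      (c := ∫ x, G x ∂μ - ∫ x, F x ∂μ)
    rw [sub_add_sub_cancel, sub_add_sub_cancel] at h3
    linarith

/-! ### Binomial moments -/

namespace SignedShifts

/-- The functional `P ↦ ∑ ε P(h)` on integer polynomials. -/
noncomputable def evalSum (l : SignedShifts) : Polynomial ℤ →ₗ[ℤ] ℤ :=
  (l.map fun q => (q.2 : ℤ) • Polynomial.leval q.1).sum

/-- The binomial moment `∑ ε (h choose i)`. -/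
noncomputable def binomialMoment (i : ℕ) (l : SignedShifts) : ℤ :=
  (l.map fun q => (q.2 : ℤ) * Ring.choose q.1 i).sum

lemma evalSum_apply (l : SignedShifts) (P : Polynomial ℤ) :
    evalSum l P = (l.map fun q => (q.2 : ℤ) * P.eval q.1).sum := by
  induction l with
  | nil => rfl
  | cons q l ih =>
    have : evalSum (q :: l) = (q.2 : ℤ) • Polynomial.leval q.1 + evalSum l := by simp [evalSum]
    rw [this, LinearMap.add_apply, ih]
    simp

lemma evalSum_X_pow (l : SignedShifts) (i : ℕ) : evalSum l (Polynomial.X ^ i) = moment i l := by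
  simp [evalSum_apply, moment]

lemma evalSum_descPochhammer (l : SignedShifts) (i : ℕ) :
    evalSum l (descPochhammer ℤ i) = i.factorial * binomialMoment i l := by
  have h : ∀ q : ℤ × ℤˣ, (descPochhammer ℤ i).eval q.1 = i.factorial * Ring.choose q.1 i :=
    fun q => by
      rw [Polynomial.eval_eq_smeval, Ring.descPochhammer_eq_factorial_smul_choose, nsmul_eq_mul]
  rw [evalSum_apply, binomialMoment, ← List.sum_map_mul_left]
  simp only [h]
  congr 1
  exact List.map_congr_left fun q _ => by ring

lemma evalSum_eq_zero_of_moments {l : SignedShifts} {d : ℕ} (h : ∀ i ≤ d, moment i l = 0)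
    {P : Polynomial ℤ} (hP : P.natDegree ≤ d) : evalSum l P = 0 := by
  rw [P.as_sum_range' (d + 1) (by omega), map_sum]
  refine Finset.sum_eq_zero fun i hi => ?_
  rw [← Polynomial.C_mul_X_pow_eq_monomial, ← Polynomial.smul_eq_C_mul, map_smul, evalSum_X_pow,
    h i (by have := Finset.mem_range.1 hi; omega), smul_zero]

/-- The falling factorials are monic, so subtracting a multiple of one lowers the degree; the change
of basis is triangular over the integers. -/
lemma evalSum_eq_zero_of_binomialMoments {l : SignedShifts} {d : ℕ}
    (h : ∀ i ≤ d, binomialMoment i l = 0) :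
    ∀ k ≤ d + 1, ∀ P : Polynomial ℤ, P.degree < k → evalSum l P = 0 := by
  intro k
  induction k with
  | zero =>
    intro _ P hP
    have : P = 0 := by
      by_contra h0
      exact absurd (Polynomial.zero_le_degree_iff.2 h0) (not_le.2 (by exact_mod_cast hP))
    rw [this, map_zero]
  | succ k ih =>
    intro hk P hP
    have h1 : evalSum l (P - P.coeff k • descPochhammer ℤ k) = 0 := by
      refine ih (by omega) _ ?_
      rw [Polynomial.degree_lt_iff_coeff_zero]
      intro m hm
      rw [Polynomial.coeff_sub, Polynomial.coeff_smul, smul_eq_mul]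
      rcases hm.eq_or_lt with rfl | hm
      · have h2 := monic_descPochhammer ℤ k
        rw [Polynomial.Monic, Polynomial.leadingCoeff, descPochhammer_natDegree] at h2
        rw [h2, mul_one, sub_self]
      · rw [(Polynomial.degree_lt_iff_coeff_zero P (k + 1)).1 hP m hm,
          Polynomial.coeff_eq_zero_of_natDegree_lt (p := descPochhammer ℤ k)
            (by rw [descPochhammer_natDegree]; exact hm), mul_zero, sub_zero]
    rwa [map_sub, map_smul, evalSum_descPochhammer, h k (by omega), mul_zero, smul_zero,
      sub_zero] at h1

/-- This joins the two sides of the proof: Taylor expansion produces power moments, unipotent orbits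
produce binomial ones. -/
lemma forall_binomialMoment_eq_zero_iff (l : SignedShifts) (d : ℕ) :
    (∀ i ≤ d, binomialMoment i l = 0) ↔ ∀ i ≤ d, moment i l = 0 := by
  constructor
  · intro h i hi
    rw [← evalSum_X_pow]
    exact evalSum_eq_zero_of_binomialMoments h (d + 1) le_rfl _
      (by rw [Polynomial.degree_X_pow]; exact_mod_cast Nat.lt_succ_of_le hi)
  · intro h i hi
    have h1 := evalSum_eq_zero_of_moments (l := l) (d := d) h (P := descPochhammer ℤ i)
      (by rw [descPochhammer_natDegree]; exact hi)
    rw [evalSum_descPochhammer] at h1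
    exact (mul_eq_zero.1 h1).resolve_left (by exact_mod_cast i.factorial_ne_zero)

end SignedShifts

/-! ### Characters of the torus -/

instance isProbabilityMeasure_unitAddCircle : IsProbabilityMeasure (volume : Measure UnitAddCircle) :=
  ⟨UnitAddCircle.measure_univ⟩

lemma integral_fourier_unitAddCircle (n : ℤ) :
    ∫ x : UnitAddCircle, fourier n x = if n = 0 then 1 else 0 := by
  split_ifs with h
  · simp [h]
  · exact integral_eq_zero_of_add_right_eq_neg (fourier_add_half_inv_index h one_pos)

lemma integral_mFourier {d : ℕ} (n : Fin d → ℤ) :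
    ∫ y : Fin d → UnitAddCircle, UnitAddTorus.mFourier n y = if n = 0 then 1 else 0 := by
  have h : ∫ y : Fin d → UnitAddCircle, UnitAddTorus.mFourier n y =
      ∏ i, ∫ x : UnitAddCircle, fourier (n i) x :=
    integral_fintype_prod_volume_eq_prod (fun i (x : UnitAddCircle) => (fourier (n i) x : ℂ))
  simp only [h, integral_fourier_unitAddCircle]
  split_ifs with h0
  · simp [h0]
  · obtain ⟨i, hi⟩ := Function.ne_iff.1 h0
    exact Finset.prod_eq_zero (Finset.mem_univ i) (if_neg hi)

/-! ### The sequences generated by unipotent maps -/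

/-- The `n`-th value along the orbit of `y` of the last coordinate. -/
noncomputable def polynomialOrbit (d : ℕ) (y : Fin (d + 1) → UnitAddCircle) (n : ℤ) :
    UnitAddCircle :=
  ∑ j : Fin (d + 1), Ring.choose n (d - j : ℕ) • y j

/-- Pascal's rule: adding to each coordinate the preceding one is the shift in the binomial basis.
-/
lemma polynomialOrbit_unipotentMap (d : ℕ) (y : Fin (d + 1) → UnitAddCircle) (n : ℤ) :
    polynomialOrbit d (unipotentMap d y) n = polynomialOrbit d y (n + 1) := by
  have h1 : polynomialOrbit d (unipotentMap d y) n = polynomialOrbit d y n +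
      ∑ j : Fin d, Ring.choose n (d - (j + 1) : ℕ) • y j.castSucc := by
    rw [polynomialOrbit, polynomialOrbit, Fin.sum_univ_succ, Fin.sum_univ_succ, add_assoc,
      ← Finset.sum_add_distrib]
    simp [unipotentMap]
  have h2 : polynomialOrbit d y (n + 1) = polynomialOrbit d y n +
      ∑ j : Fin d, Ring.choose n (d - (j + 1) : ℕ) • y j.castSucc := by
    rw [polynomialOrbit, polynomialOrbit, Fin.sum_univ_castSucc, Fin.sum_univ_castSucc,
      add_right_comm, ← Finset.sum_add_distrib]
    congr 1
    · refine Finset.sum_congr rfl fun j _ => ?_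
      obtain ⟨k, hk⟩ : ∃ k, d - (j : ℕ) = k + 1 := ⟨d - (j : ℕ) - 1, by omega⟩
      have hk' : d - ((j : ℕ) + 1) = k := by omega
      rw [Fin.val_castSucc, hk, hk', Ring.choose_succ_succ, add_smul, add_comm]
    · simp
  rw [h1, h2]

lemma coe_toCircle_sum {ι : Type*} (I : Finset ι) (x : ι → UnitAddCircle) :
    ((AddCircle.toCircle (∑ i ∈ I, x i) : Circle) : ℂ) =
      ∏ i ∈ I, ((AddCircle.toCircle (x i) : Circle) : ℂ) := by
  classical
  induction I using Finset.induction_on with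
  | empty => simp
  | insert i I hi ih =>
    rw [Finset.sum_insert hi, Finset.prod_insert hi, AddCircle.toCircle_add, Circle.coe_mul, ih]

/-- The point of the sequence space generated by `y`. -/
noncomputable def orbitPoint (d : ℕ) (y : Fin (d + 1) → UnitAddCircle) : SeqSpace := fun n =>
  ⟨AddCircle.toCircle (polynomialOrbit d y n), mem_closedBall_zero_iff.2 (Circle.norm_coe _).le⟩

lemma coe_orbitPoint (d : ℕ) (y : Fin (d + 1) → UnitAddCircle) (n : ℤ) :
    (orbitPoint d y n : ℂ) = UnitAddTorus.mFourier (fun j : Fin (d + 1) => Ring.choose n (d - j : ℕ)) y := by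
  change ((AddCircle.toCircle (∑ j : Fin (d + 1), Ring.choose n (d - j : ℕ) • y j) : Circle) : ℂ) =
    ∏ j : Fin (d + 1), fourier (Ring.choose n (d - j : ℕ)) (y j)
  simp only [fourier_apply]
  exact coe_toCircle_sum _ _

/-- Each value of the orbit is a character of `y`, and multiplying or conjugating characters adds or
negates frequencies. -/
lemma coordMonomial_orbitPoint (d : ℕ) (y : Fin (d + 1) → UnitAddCircle) (l : SignedShifts) :
    coordMonomial l (orbitPoint d y) =
      UnitAddTorus.mFourier (fun j : Fin (d + 1) => SignedShifts.binomialMoment (d - j : ℕ) l) y := by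
  induction l with
  | nil =>
    have : (fun j : Fin (d + 1) => SignedShifts.binomialMoment (d - j : ℕ) []) = 0 := rfl
    rw [this, UnitAddTorus.mFourier_zero]; rfl
  | cons q l ih =>
    have h : (fun j : Fin (d + 1) => SignedShifts.binomialMoment (d - j : ℕ) (q :: l)) =
        (fun j : Fin (d + 1) => (q.2 : ℤ) * Ring.choose q.1 (d - j : ℕ)) +
        fun j : Fin (d + 1) => SignedShifts.binomialMoment (d - j : ℕ) l := by
      funext j; simp [SignedShifts.binomialMoment]
    rw [coordMonomial_cons, ih, h, UnitAddTorus.mFourier_add, signedCoord_apply, coe_orbitPoint]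
    congr 1
    rcases Int.units_eq_one_or q.2 with h | h
    · simp [h]
    · have h1 : (-1 : ℤˣ) ≠ 1 := by decide
      rw [h, if_neg h1, ← UnitAddTorus.mFourier_neg]
      simp
      rfl

lemma continuous_orbitPoint (d : ℕ) : Continuous (orbitPoint d) := by
  refine continuous_pi fun n => Continuous.subtype_mk ?_ _
  have : (fun y => ((AddCircle.toCircle (polynomialOrbit d y n) : Circle) : ℂ)) =
      UnitAddTorus.mFourier (fun j : Fin (d + 1) => Ring.choose n (d - j : ℕ)) :=
    funext fun y => coe_orbitPoint d y n
  rw [this]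
  exact ContinuousMap.continuous _

/-- A character has integral `1` if it is trivial and `0` otherwise; its frequencies are the
binomial moments up to `d`. -/
lemma integral_coordMonomial_orbitPoint (d : ℕ) (l : SignedShifts) :
    ∫ y, coordMonomial l (orbitPoint d y) =
      open Classical in if ∀ i ≤ d, SignedShifts.moment i l = 0 then 1 else 0 := by
  simp only [coordMonomial_orbitPoint, integral_mFourier,
    ← SignedShifts.forall_binomialMoment_eq_zero_iff]
  congr 1
  rw [funext_iff, eq_iff_iff]
  constructor
  · intro h i hi
    have := h ⟨d - i, by omega⟩
    simpa [Nat.sub_sub_self hi] using this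
  · intro h j
    exact h _ (Nat.sub_le _ _)

/-- The model map from the mixture to the sequence space. -/
noncomputable def mixturePoint (c : ℝ) (z : MixtureSpace c) : SeqSpace := orbitPoint z.1.1 z.2

lemma mixturePoint_mixtureMap (c : ℝ) (z : MixtureSpace c) :
    mixturePoint c (mixtureMap c z) = shift (mixturePoint c z) := by
  funext n
  exact Subtype.ext (congrArg (fun x => ((AddCircle.toCircle x : Circle) : ℂ))
    (polynomialOrbit_unipotentMap z.1.1 z.2 n))

lemma measurable_of_forall_level {c : ℝ} {β : Type*} [MeasurableSpace β] {g : MixtureSpace c → β}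
    (h : ∀ d, Measurable fun y => g ⟨d, y⟩) : Measurable g := by
  intro s hs
  exact MeasurableSpace.measurableSet_iInf.2 fun d => h d hs

lemma measurable_level (c : ℝ) (d : {d : ℕ // ⌊c⌋₊ ≤ d}) :
    Measurable fun y : Fin (d.1 + 1) → UnitAddCircle => (⟨d, y⟩ : MixtureSpace c) :=
  fun _ hs => MeasurableSpace.measurableSet_iInf.1 hs d

lemma measurable_mixturePoint (c : ℝ) : Measurable (mixturePoint c) :=
  measurable_of_forall_level fun d => (continuous_orbitPoint d.1).measurable

instance isProbabilityMeasure_levelMeasure (c : ℝ) (d : {d : ℕ // ⌊c⌋₊ ≤ d}) :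
    IsProbabilityMeasure (levelMeasure c d) :=
  Measure.isProbabilityMeasure_map (measurable_level c d).aemeasurable

/-! ### The weights of the mixture -/

/-- The enumeration of the natural numbers from `a` on. -/
def natShiftEquiv (a : ℕ) : ℕ ≃ {d : ℕ // a ≤ d} where
  toFun j := ⟨a + j, Nat.le_add_right a j⟩
  invFun d := d.1 - a
  left_inv j := by simp
  right_inv d := Subtype.ext (by have := d.2; simp only; omega)

lemma hasSum_weights {a : ℕ} (ha : 1 ≤ a) :
    HasSum (fun d : {d : ℕ // a ≤ d} => 1 / (d.1 : ℝ) - 1 / ((d.1 : ℝ) + 1)) (1 / a) := by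
  rw [← (natShiftEquiv a).hasSum_iff]
  have ha' : (1 : ℝ) ≤ a := by exact_mod_cast ha
  have hs : ∀ n, ∑ j ∈ Finset.range n, ((fun d : {d : ℕ // a ≤ d} => 1 / (d.1 : ℝ) -
      1 / ((d.1 : ℝ) + 1)) ∘ natShiftEquiv a) j = 1 / a - 1 / ((a : ℝ) + n) := fun n => by
    have := Finset.sum_range_sub' (fun j : ℕ => 1 / ((a : ℝ) + j)) n
    simp only [Nat.cast_zero, add_zero] at this
    rw [← this]
    refine Finset.sum_congr rfl fun j _ => ?_
    simp [natShiftEquiv, add_assoc]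
  rw [hasSum_iff_tendsto_nat_of_nonneg]
  · simp only [hs]
    have : Tendsto (fun n : ℕ => 1 / ((a : ℝ) + n)) atTop (𝓝 0) :=
      tendsto_const_nhds.div_atTop (tendsto_atTop_add_const_left _ _ tendsto_natCast_atTop_atTop)
    simpa using this.const_sub (1 / (a : ℝ))
  · intro j
    simp only [Function.comp_apply, natShiftEquiv, Equiv.coe_fn_mk, Nat.cast_add, sub_nonneg]
    refine one_div_le_one_div_of_le (by positivity) (by linarith)

lemma hasSum_weights_lt {a k : ℕ} (hak : a ≤ k) :
    HasSum (fun d : {d : ℕ // a ≤ d} =>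
      (1 / (d.1 : ℝ) - 1 / ((d.1 : ℝ) + 1)) * if d.1 < k then 1 else 0) (1 / a - 1 / k) := by
  rw [← (natShiftEquiv a).hasSum_iff]
  have h : ∀ j ∉ Finset.range (k - a), ((fun d : {d : ℕ // a ≤ d} =>
      (1 / (d.1 : ℝ) - 1 / ((d.1 : ℝ) + 1)) * if d.1 < k then 1 else 0) ∘ natShiftEquiv a) j = 0 := by
    intro j hj
    rw [Finset.mem_range] at hj
    have : ¬ (a + j < k) := by omega
    simp [natShiftEquiv, this]
  convert hasSum_sum_of_ne_finset_zero (L := .unconditional ℕ) h using 1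
  have := Finset.sum_range_sub' (fun j : ℕ => 1 / ((a : ℝ) + j)) (k - a)
  rw [Nat.cast_zero, add_zero, Nat.cast_sub hak, add_sub_cancel] at this
  rw [← this]
  refine Finset.sum_congr rfl fun j hj => ?_
  rw [Finset.mem_range] at hj
  have : a + j < k := by omega
  simp [natShiftEquiv, this, add_assoc]

lemma one_sub_div_ceil_nonneg {c : ℝ} (hc : 0 < c) : 0 ≤ 1 - c / ⌈c⌉₊ := by
  have h1 : (0 : ℝ) < ⌈c⌉₊ := by exact_mod_cast Nat.ceil_pos.2 hc
  have h2 : c / ⌈c⌉₊ ≤ 1 := (div_le_one h1).2 (Nat.le_ceil c)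
  linarith

lemma weight_nonneg {d : ℕ} (hd : 1 ≤ d) : 0 ≤ 1 / (d : ℝ) - 1 / ((d : ℝ) + 1) := by
  have : (0 : ℝ) < d := by exact_mod_cast hd
  rw [sub_nonneg]
  exact one_div_le_one_div_of_le this (by linarith)

instance isProbabilityMeasure_mixtureMeasure {c : ℝ} [hc : Fact (0 < c)] :
    IsProbabilityMeasure (mixtureMeasure c) := by
  have hc := hc.out
  have hpos : 1 ≤ ⌈c⌉₊ := Nat.ceil_pos.2 hc
  have hw : ∀ d : {d : ℕ // ⌈c⌉₊ ≤ d}, 0 ≤ 1 / (d.1 : ℝ) - 1 / ((d.1 : ℝ) + 1) :=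
    fun d => weight_nonneg (hpos.trans d.2)
  refine ⟨?_⟩
  rw [mixtureMeasure, Measure.add_apply, Measure.smul_apply, Measure.smul_apply, measure_univ,
    Measure.sum_apply _ MeasurableSet.univ]
  simp only [Measure.smul_apply, measure_univ, smul_eq_mul, mul_one]
  rw [← ENNReal.ofReal_tsum_of_nonneg hw (hasSum_weights hpos).summable,
    (hasSum_weights hpos).tsum_eq, ← ENNReal.ofReal_mul hc.le,
    ← ENNReal.ofReal_add (one_sub_div_ceil_nonneg hc) (by positivity), mul_one_div,
    sub_add_cancel, ENNReal.ofReal_one]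

lemma integral_mixtureMeasure_eq {c : ℝ} (hc : 0 < c) {g : MixtureSpace c → ℂ}
    (hg : Measurable g) (hb : ∀ z, ‖g z‖ ≤ 1) {A : ℂ}
    (hA : HasSum (fun d : {d : ℕ // ⌈c⌉₊ ≤ d} => ((1 / (d.1 : ℝ) - 1 / ((d.1 : ℝ) + 1) : ℝ) : ℂ) *
      ∫ y, g ⟨⟨d.1, (Nat.floor_le_ceil c).trans d.2⟩, y⟩) A) :
    ∫ z, g z ∂mixtureMeasure c =
      ((1 - c / ⌈c⌉₊ : ℝ) : ℂ) * (∫ y, g ⟨⟨⌊c⌋₊, le_rfl⟩, y⟩) + c * A := by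
  have := Fact.mk hc
  have hpos : 1 ≤ ⌈c⌉₊ := Nat.ceil_pos.2 hc
  have hint : Integrable g (mixtureMeasure c) :=
    Integrable.of_bound hg.aestronglyMeasurable 1 (Eventually.of_forall hb)
  have hlev : ∀ d, ∫ z, g z ∂levelMeasure c d = ∫ y, g ⟨d, y⟩ := fun d =>
    integral_map (measurable_level c d).aemeasurable hg.aestronglyMeasurable
  rw [mixtureMeasure] at hint ⊢
  have hint1 := hint.left_of_add_measure
  have hint2 := hint.right_of_add_measure
  rw [integral_add_measure hint1 hint2, integral_smul_measure, integral_smul_measure, hlev,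
    ENNReal.toReal_ofReal (one_sub_div_ceil_nonneg hc), ENNReal.toReal_ofReal hc.le]
  have hint3 := (integrable_smul_measure (by simpa using hc) ENNReal.ofReal_ne_top).1 hint2
  have h3 := hasSum_integral_measure hint3
  simp only [integral_smul_measure, hlev] at h3
  have h4 : (fun d : {d : ℕ // ⌈c⌉₊ ≤ d} =>
      (ENNReal.ofReal (1 / (d.1 : ℝ) - 1 / ((d.1 : ℝ) + 1))).toReal •
        ∫ y, g ⟨⟨d.1, (Nat.floor_le_ceil c).trans d.2⟩, y⟩) = fun d : {d : ℕ // ⌈c⌉₊ ≤ d} =>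
      ((1 / (d.1 : ℝ) - 1 / ((d.1 : ℝ) + 1) : ℝ) : ℂ) *
        ∫ y, g ⟨⟨d.1, (Nat.floor_le_ceil c).trans d.2⟩, y⟩ := by
    funext d
    rw [ENNReal.toReal_ofReal (weight_nonneg (hpos.trans d.2)), Complex.real_smul]
  rw [h4] at h3
  rw [hA.unique h3, Complex.real_smul, Complex.real_smul]

/-- The correlations of the model measure. -/
theorem integral_coordMonomial_mixturePoint {c : ℝ} (hc : 0 < c) (l : SignedShifts) :
    ∫ z, coordMonomial l (mixturePoint c z) ∂mixtureMeasure c =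
      ((SignedShifts.correlation c l : ℝ) : ℂ) := by
  classical
  have hpos : 1 ≤ ⌈c⌉₊ := Nat.ceil_pos.2 hc
  have hmain : ∀ A : ℝ, HasSum (fun d : {d : ℕ // ⌈c⌉₊ ≤ d} =>
      (1 / (d.1 : ℝ) - 1 / ((d.1 : ℝ) + 1)) *
        if ∀ i ≤ d.1, SignedShifts.moment i l = 0 then 1 else 0) A →
      ∫ z, coordMonomial l (mixturePoint c z) ∂mixtureMeasure c =
        (((1 - c / ⌈c⌉₊) * (if ∀ i ≤ ⌊c⌋₊, SignedShifts.moment i l = 0 then 1 else 0) +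
          c * A : ℝ) : ℂ) := by
    intro A hA
    rw [integral_mixtureMeasure_eq hc (A := (A : ℂ))
      (g := fun z => coordMonomial l (mixturePoint c z))
      ((coordMonomial l).continuous.measurable.comp (measurable_mixturePoint c))
      (fun z => norm_coordMonomial_le l _)]
    · simp only [mixturePoint, integral_coordMonomial_orbitPoint]
      push_cast
      congr! 2
      split_ifs <;> simp
    · convert Complex.hasSum_ofReal.2 hA using 2 with d
      simp only [mixturePoint, integral_coordMonomial_orbitPoint]
      push_cast
      congr 1
      split_ifs <;> simp
  rcases SignedShifts.moments_trichotomy l with h | h | ⟨k, hl, hk⟩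
  · rw [SignedShifts.correlation_of_forall h, hmain (1 / ⌈c⌉₊)]
    · rw [if_pos fun i _ => h i]
      congr 1
      field_simp
      ring
    · simpa only [h, implies_true, if_true, mul_one] using hasSum_weights hpos
  · have h0 : ∀ d, ¬ ∀ i ≤ d, SignedShifts.moment i l = 0 := fun d h' => h (h' 0 (Nat.zero_le d))
    rw [SignedShifts.correlation_of_moment_zero_ne h, hmain 0]
    · rw [if_neg (h0 _)]; simp
    · simp only [h0, if_false, mul_zero]; exact hasSum_zero
  · have h0 : ∀ d, (∀ i ≤ d, SignedShifts.moment i l = 0) ↔ d < k + 1 := fun d =>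
      ⟨fun h' => by by_contra! hd; exact hk (h' _ hd), fun hd i hi => hl i (by omega)⟩
    have hk0 : (0 : ℝ) < (k + 1 : ℕ) := by positivity
    rw [SignedShifts.correlation_of_order hl hk]
    simp only [h0] at hmain
    -- Levels `d < k + 1` count fully and the others not at all. If `⌊c⌋ < k + 1` the weights give
    -- `(1 - c / ⌈c⌉) + c * (1 / ⌈c⌉ - 1 / (k + 1)) = 1 - c / (k + 1)`; otherwise no level counts
    -- and the maximum is `0`.
    rcases lt_or_ge ⌊c⌋₊ (k + 1) with hck | hck
    · have hck' : c ≤ (k + 1 : ℕ) := by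
        have := (Nat.floor_lt hc.le).1 hck
        exact this.le
      rw [hmain _ (hasSum_weights_lt (Nat.ceil_le.2 hck')), if_pos hck,
        max_eq_right (by rw [sub_nonneg, div_le_one hk0]; exact hck')]
      congr 1
      field_simp
      ring
    · have hck' : ((k + 1 : ℕ) : ℝ) ≤ c := (Nat.le_floor_iff hc.le).1 hck
      have h1 : ∀ d : {d : ℕ // ⌈c⌉₊ ≤ d}, ¬ d.1 < k + 1 := fun d => by
        have := d.2
        have := Nat.floor_le_ceil c
        omega
      rw [hmain 0, if_neg (by omega),
        max_eq_left (by rw [sub_nonpos, one_le_div hk0]; exact hck')]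
      · simp
      · simp only [h1, if_false, mul_zero]; exact hasSum_zero

/-! ### Invariance and strong stationarity -/

namespace SignedShifts

lemma translate_translate (h h' : ℤ) (l : SignedShifts) :
    translate h (translate h' l) = translate (h' + h) l := by
  simp [translate, Function.comp_def, add_assoc]

@[simp] lemma translate_zero (l : SignedShifts) : translate 0 l = l := by
  simp [translate]

lemma correlation_translate (c : ℝ) (h : ℤ) (l : SignedShifts) :
    correlation c (translate h l) = correlation c l := by
  have key : ∀ (h : ℤ) (l : SignedShifts) (d : ℕ), (∀ i < d, moment i l = 0) →
      ∀ i < d, moment i (translate h l) = 0 := fun h l d hl i hi => by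
    rw [moment_translate_eq hl h i hi.le, hl i hi]
  refine (correlation_congr c (key h l) fun d hd => ?_).symm
  have := key (-h) (translate h l) d hd
  rwa [translate_translate, add_neg_cancel, translate_zero] at this

/-- The correlation of a monomial with its shift does not depend on the shift, as long as the
latter is not trivial. -/
lemma exists_correlation_difference_eq (c : ℝ) (l : SignedShifts) :
    ∃ γ : ℝ, ∀ n m : ℤ, n ≠ m →
      correlation c (translate n l ++ opposite (translate m l)) = γ := by
  have key : ∀ k, (∀ i < k, moment i l = 0) → ∀ n m, ∀ i < k + 1,
      moment i (translate n l ++ opposite (translate m l)) = 0 := by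
    intro k hl n m i hi
    rw [moment_append, moment_opposite, moment_translate_eq hl _ i (by omega),
      moment_translate_eq hl _ i (by omega), add_neg_cancel]
  have key' : ∀ k, (∀ i < k, moment i l = 0) → moment k l ≠ 0 → ∀ n m, n ≠ m →
      moment (k + 1) (translate n l ++ opposite (translate m l)) ≠ 0 := by
    intro k hl hk n m hnm
    rw [moment_append, moment_opposite, moment_succ_translate hl, moment_succ_translate hl]
    have e : ((k : ℤ) + 1) * n * moment k l + moment (k + 1) l +
        -((k + 1) * m * moment k l + moment (k + 1) l) = (k + 1) * (n - m) * moment k l := by ring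
    rw [e]
    exact mul_ne_zero (mul_ne_zero (by positivity) (sub_ne_zero.2 hnm)) hk
  rcases moments_trichotomy l with h | h | ⟨k, hl, hk⟩
  · exact ⟨1, fun n m _ => correlation_of_forall fun i =>
      key i (fun j _ => h j) n m i (Nat.lt_succ_self i)⟩
  · exact ⟨_, fun n m hnm => correlation_of_order (key 0 (by simp) n m)
      (key' 0 (by simp) h n m hnm)⟩
  · exact ⟨_, fun n m hnm => correlation_of_order (key (k + 1) hl n m) (key' (k + 1) hl hk n m hnm)⟩

end SignedShifts

lemma continuous_shift : Continuous shift :=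
  continuous_pi fun n => continuous_apply (n + 1)

lemma measurePreserving_shift {c : ℝ} {μ : Measure SeqSpace} [IsProbabilityMeasure μ]
    (hμ : ∀ l, ∫ x, coordMonomial l x ∂μ = ((SignedShifts.correlation c l : ℝ) : ℂ)) :
    MeasurePreserving shift μ μ := by
  refine ⟨continuous_shift.measurable, ?_⟩
  have : IsProbabilityMeasure (μ.map shift) :=
    Measure.isProbabilityMeasure_map continuous_shift.measurable.aemeasurable
  refine ext_of_integral_coordMonomial fun l => ?_
  rw [integral_map continuous_shift.measurable.aemeasurable
    (coordMonomial l).continuous.aestronglyMeasurable]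
  have : ∀ x, coordMonomial l (shift x) = coordMonomial (SignedShifts.translate 1 l) x :=
    coordMonomial_shiftPow l 1
  simp only [this, hμ, SignedShifts.correlation_translate]

lemma coordMonomial_ofFn {k : ℕ} (q : Fin k → ℤ × ℤˣ) (x : SeqSpace) :
    coordMonomial (List.ofFn q) x = ∏ j, signedCoord (q j) x := by
  rw [coordMonomial, List.map_ofFn, List.prod_ofFn, ContinuousMap.prod_apply]
  rfl

/-- Dilating the shifts by `r` multiplies the moment of order `i` by `r ^ i ≠ 0`, so the order does
not change. -/
lemma stronglyStationary_of_correlation {c : ℝ} {μ : Measure SeqSpace}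
    (hμ : ∀ l, ∫ x, coordMonomial l x ∂μ = ((SignedShifts.correlation c l : ℝ) : ℂ)) :
    StronglyStationary μ := by
  intro k r hr n F hF
  have hε : ∀ j, ∃ ε : ℤˣ, ∀ (m : ℤ) (x : SeqSpace), F j (shiftPow m x) = signedCoord (m, ε) x := by
    intro j
    rcases hF j with h | h
    · refine ⟨1, fun m x => ?_⟩
      rw [h, signedCoord_apply, if_pos rfl, coordZero, shiftPow, zero_add]
    · refine ⟨-1, fun m x => ?_⟩
      rw [h, signedCoord_apply, if_neg (by simp)]
      simp only [coordZero, shiftPow, zero_add]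
  choose ε hε using hε
  simp only [hε, ← coordMonomial_ofFn (fun j => (_, ε j)), hμ]
  have hmom : ∀ i, SignedShifts.moment i (List.ofFn fun j => ((r : ℤ) * n j, ε j)) =
      (r : ℤ) ^ i * SignedShifts.moment i (List.ofFn fun j => (n j, ε j)) := by
    intro i
    rw [SignedShifts.moment, SignedShifts.moment, List.map_ofFn, List.map_ofFn, List.sum_ofFn,
      List.sum_ofFn, Finset.mul_sum]
    refine Finset.sum_congr rfl fun j _ => ?_
    simp only [Function.comp_apply]
    ring
  have hr' : (r : ℤ) ≠ 0 := by exact_mod_cast hr.ne'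
  congr 1
  refine SignedShifts.correlation_congr c (fun d hd i hi => ?_) (fun d hd i hi => ?_)
  · rw [hmom, hd i hi, mul_zero]
  · have := hd i hi
    rw [hmom] at this
    exact (mul_eq_zero.1 this).resolve_left (pow_ne_zero i hr')

/-! ### The spectrum -/

/-- Bessel: a vector has small inner product with some member of a bounded orthogonal sequence. -/
lemma eq_zero_of_norm_inner_eq {E : Type*} [NormedAddCommGroup E] [InnerProductSpace ℂ E]
    {w : ℕ → E} (hw : ∀ i j, i ≠ j → inner ℂ (w i) (w j) = 0) {C : ℝ} (hC : ∀ j, ‖w j‖ ≤ C) {G : E}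
    {δ : ℝ} (hδ : ∀ j, ‖inner ℂ (w j) G‖ = δ) : δ = 0 := by
  by_contra h0
  have hw0 : ∀ j, w j ≠ 0 := fun j hj => h0 (by rw [← hδ j, hj, inner_zero_left, norm_zero])
  have hpos : ∀ j, 0 < ‖w j‖ := fun j => norm_pos_iff.2 (hw0 j)
  have hC0 : 0 < C := (hpos 0).trans_le (hC 0)
  have hδ0 : 0 < δ := lt_of_le_of_ne (by rw [← hδ 0]; exact norm_nonneg _) (Ne.symm h0)
  have hon : Orthonormal ℂ fun j => ((‖w j‖ : ℂ))⁻¹ • w j := by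
    refine ⟨fun j => ?_, fun i j hij => ?_⟩
    · rw [norm_smul, norm_inv, Complex.norm_real, norm_norm, inv_mul_cancel₀ (hpos j).ne']
    · simp only [inner_smul_left, inner_smul_right, hw i j hij, mul_zero]
  obtain ⟨N, hN⟩ := exists_nat_gt (‖G‖ ^ 2 / (δ / C) ^ 2)
  rw [div_lt_iff₀ (by positivity)] at hN
  have hB := hon.sum_inner_products_le G (s := Finset.range N)
  have hterm : ∀ j ∈ Finset.range N, (δ / C) ^ 2 ≤ ‖inner ℂ (((‖w j‖ : ℂ))⁻¹ • w j) G‖ ^ 2 := by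
    intro j _
    rw [inner_smul_left, norm_mul, hδ, RCLike.norm_conj, norm_inv, Complex.norm_real, norm_norm,
      inv_mul_eq_div]
    have := hpos j
    gcongr
    exact hC j
  have := (Finset.sum_le_sum hterm).trans hB
  rw [Finset.sum_const, Finset.card_range, nsmul_eq_mul] at this
  linarith

lemma toLp_eq_zero_of_inner_coordMonomial {μ : Measure SeqSpace} [IsProbabilityMeasure μ]
    {G : Lp ℂ 2 μ} (hG : ∀ l, inner ℂ (ContinuousMap.toLp 2 μ ℂ (coordMonomial l)) G = 0) :
    G = 0 := by
  have key : ∀ F : C(SeqSpace, ℂ), inner ℂ (ContinuousMap.toLp 2 μ ℂ F) G = 0 := by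
    refine coordMonomial_induction hG (fun F H hF hH => ?_) (fun r F hF => ?_) fun F hF => ?_
    · rw [map_add, inner_add_left, hF, hH, add_zero]
    · rw [map_smul, inner_smul_left, hF, mul_zero]
    · rw [← norm_le_zero_iff]
      refine le_of_forall_pos_le_add fun ε hε => ?_
      set K := ‖(ContinuousMap.toLp 2 μ ℂ : C(SeqSpace, ℂ) →L[ℂ] Lp ℂ 2 μ)‖ with hK
      have hpos : 0 < K * ‖G‖ + 1 := by positivity
      obtain ⟨H, hH, hd⟩ := hF (ε / (K * ‖G‖ + 1)) (by positivity)
      have h1 : inner ℂ (ContinuousMap.toLp 2 μ ℂ F) G =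
          inner ℂ (ContinuousMap.toLp 2 μ ℂ (F - H)) G := by
        rw [map_sub, inner_sub_left, hH, sub_zero]
      rw [h1, zero_add]
      rw [le_div_iff₀ hpos] at hd
      calc _ ≤ ‖ContinuousMap.toLp 2 μ ℂ (F - H)‖ * ‖G‖ := norm_inner_le_norm _ _
        _ ≤ (K * ‖F - H‖) * ‖G‖ := by gcongr; exact ContinuousLinearMap.le_opNorm _ _
        _ ≤ ε := by nlinarith [norm_nonneg (F - H)]
  exact (ContinuousMap.toLp_denseRange (p := 2) ℂ μ ℂ ENNReal.ofNat_ne_top).eq_zero_of_inner_right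
    ℂ key

lemma norm_toLp_coordMonomial_le (μ : Measure SeqSpace) [IsProbabilityMeasure μ]
    (l : SignedShifts) : ‖ContinuousMap.toLp 2 μ ℂ (coordMonomial l)‖ ≤ 1 := by
  rw [← sq_le_one_iff₀ (norm_nonneg _), ← inner_self_eq_norm_sq (𝕜 := ℂ), ContinuousMap.inner_toLp]
  refine (RCLike.re_le_norm _).trans ((norm_integral_le_of_norm_le_const (C := 1)
    (Eventually.of_forall fun x => ?_)).trans (by simp))
  rw [norm_mul, RCLike.norm_conj]
  exact mul_le_one₀ (norm_coordMonomial_le l x) (norm_nonneg _) (norm_coordMonomial_le l x)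

/-- Let `v n` be the translates of a monomial. They have one common inner product for distinct
indices, so the differences `v (2 j) - v (2 j + 1)` are orthogonal. An eigenfunction pairs with all
of them with the same modulus, a multiple of `‖lam - 1‖`. Bessel forces this to be `0`, so for `lam
≠ 1` the eigenfunction is orthogonal to every monomial and vanishes. -/
theorem systemSpectrum_eq_zero {c : ℝ} {μ : Measure SeqSpace} [IsProbabilityMeasure μ]
    (hμ : ∀ l, ∫ x, coordMonomial l x ∂μ = ((SignedShifts.correlation c l : ℝ) : ℂ)) :
    systemSpectrum μ shift = {0} := by
  refine Set.Subset.antisymm (fun α hα => ?_) ?_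
  · obtain ⟨⟨hα0, hα1⟩, g, hg, hgne, hge⟩ := hα
    by_contra hne
    rw [Set.mem_singleton_iff] at hne
    set lam : ℂ := Complex.exp (2 * Real.pi * Complex.I * α) with hlam
    have hlam_norm : ‖lam‖ = 1 := by
      have : (2 * Real.pi * Complex.I * α : ℂ) = ((2 * Real.pi * α : ℝ) : ℂ) * Complex.I := by
        push_cast; ring
      rw [hlam, this, Complex.norm_exp_ofReal_mul_I]
    have hlam_ne : lam ≠ 1 := by
      intro h
      obtain ⟨n, hn⟩ := Complex.exp_eq_one_iff.1 h
      have h2 : (α : ℂ) = n := by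
        have : (2 * Real.pi * Complex.I : ℂ) ≠ 0 := Complex.two_pi_I_ne_zero
        apply mul_left_cancel₀ this
        rw [hn]; ring
      have h3 : α = n := by exact_mod_cast h2
      have h4 : (-1 : ℝ) < n := by linarith
      have h5 : (n : ℝ) < 1 := by linarith
      have h6 : -1 < n := by exact_mod_cast h4
      have h7 : n < 1 := by exact_mod_cast h5
      have h8 : n = 0 := by omega
      exact hne (by rw [h3, h8]; simp)
    have hT := measurePreserving_shift hμ
    apply hgne
    rw [← hg.coeFn_toLp.congr_left, ← Lp.eq_zero_iff_ae_eq_zero]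
    refine toLp_eq_zero_of_inner_coordMonomial fun l => ?_
    set v : ℤ → Lp ℂ 2 μ := fun n =>
      ContinuousMap.toLp 2 μ ℂ (coordMonomial (SignedShifts.translate n l)) with hv
    set G : Lp ℂ 2 μ := hg.toLp g with hG
    obtain ⟨γ, hγ⟩ := SignedShifts.exists_correlation_difference_eq c l
    have hvv : ∀ n m, n ≠ m → inner ℂ (v n) (v m) = (γ : ℂ) := by
      intro n m hnm
      rw [hv, ContinuousMap.inner_toLp, ← hγ m n hnm.symm, ← hμ]
      refine integral_congr_ae (Eventually.of_forall fun x => ?_)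
      simp only [coordMonomial_append, ContinuousMap.mul_apply, coordMonomial_opposite]
    have hvG : ∀ n, inner ℂ (v n) G =
        ∫ x, g x * starRingEnd ℂ (coordMonomial (SignedShifts.translate n l) x) ∂μ := by
      intro n
      rw [L2.inner_def]
      refine integral_congr_ae ?_
      filter_upwards [ContinuousMap.coeFn_toLp (p := 2) (𝕜 := ℂ) μ
        (coordMonomial (SignedShifts.translate n l)), hg.coeFn_toLp] with x h1 h2
      rw [hv, hG, h2]
      simp only [h1]
      rfl
    -- Change of variables by the shift: the eigenfunction contributes `lam`, the monomial moves to
    -- its next translate.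
    have hstep : ∀ n, inner ℂ (v n) G = lam * inner ℂ (v (n + 1)) G := by
      intro n
      rw [hvG, hvG, ← integral_const_mul]
      conv_lhs => rw [← hT.map_eq]
      rw [integral_map hT.measurable.aemeasurable]
      · refine integral_congr_ae ?_
        filter_upwards [hge] with x hx
        have : coordMonomial (SignedShifts.translate n l) (shift x) =
            coordMonomial (SignedShifts.translate (n + 1) l) x := by
          rw [shift, coordMonomial_shiftPow, SignedShifts.translate_translate]
        rw [hx, this, mul_assoc]
      · rw [hT.map_eq]
        exact hg.aestronglyMeasurable.mul
          (Complex.continuous_conj.comp (ContinuousMap.continuous _)).aestronglyMeasurable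
    have hnorm : ∀ n : ℕ, ‖inner ℂ (v n) G‖ = ‖inner ℂ (v 0) G‖ := by
      intro n
      induction n with
      | zero => rfl
      | succ n ih => rw [← ih, hstep n, norm_mul, hlam_norm, one_mul]; push_cast; rfl
    have hδ : ∀ j : ℕ, ‖inner ℂ (v (2 * j : ℕ) - v (2 * j + 1 : ℕ)) G‖ =
        ‖lam - 1‖ * ‖inner ℂ (v 0) G‖ := by
      intro j
      have h1 := hstep (2 * j : ℕ)
      have h2 : ((2 * j : ℕ) : ℤ) + 1 = ((2 * j + 1 : ℕ) : ℤ) := by push_cast; rfl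
      rw [h2] at h1
      rw [inner_sub_left, h1, ← hnorm (2 * j + 1), ← norm_mul, sub_mul, one_mul]
    -- For `i ≠ j` the four indices are distinct across the pairs, so orthogonality reads `γ - γ - γ
    -- + γ = 0`.
    have hzero := eq_zero_of_norm_inner_eq (w := fun j : ℕ => v (2 * j : ℕ) - v (2 * j + 1 : ℕ))
      (C := 2) (fun i j hij => by
        simp only [inner_sub_left, inner_sub_right]
        rw [hvv _ _ (by omega), hvv _ _ (by omega), hvv _ _ (by omega), hvv _ _ (by omega)]
        ring)
      (fun j => (norm_sub_le _ _).trans (by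
        have h1 := norm_toLp_coordMonomial_le μ (SignedShifts.translate (2 * j : ℕ) l)
        have h2 := norm_toLp_coordMonomial_le μ (SignedShifts.translate (2 * j + 1 : ℕ) l)
        linarith)) hδ
    have h0 := (mul_eq_zero.1 hzero).resolve_left (norm_ne_zero_iff.2 (sub_ne_zero.2 hlam_ne))
    rw [norm_eq_zero, hv] at h0
    simpa only [SignedShifts.translate_zero] using h0
  · rintro α rfl
    refine ⟨⟨le_rfl, one_pos⟩, fun _ => 1, memLp_const 1, fun h => ?_, by simp⟩
    obtain ⟨x, hx⟩ := h.exists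
    exact one_ne_zero hx

/-! ### The isomorphism with the mixture -/

/-- Needed to see the mixture space as standard Borel, so that injective measurable images and
inverses can be used. -/
instance borelSpace_sigma {ι : Type*} [Countable ι] {X : ι → Type*} [∀ i, TopologicalSpace (X i)]
    [∀ i, MeasurableSpace (X i)] [∀ i, BorelSpace (X i)] : BorelSpace (Σ i, X i) := by
  refine ⟨le_antisymm (fun s hs => ?_) (MeasurableSpace.generateFrom_le fun s hs => ?_)⟩
  · have h : s = ⋃ i, Sigma.mk i '' (Sigma.mk i ⁻¹' s) := by
      refine Set.Subset.antisymm (fun ⟨i, x⟩ hx => Set.mem_iUnion.2 ⟨i, x, hx, rfl⟩) ?_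
      exact Set.iUnion_subset fun i => Set.image_preimage_subset _ _
    rw [h]
    borelize (Σ i, X i)
    refine MeasurableSet.iUnion fun i => ?_
    have hi : MeasurableSet (Sigma.mk i ⁻¹' s) := MeasurableSpace.measurableSet_iInf.1 hs i
    exact Topology.IsOpenEmbedding.sigmaMk.measurableEmbedding.measurableSet_image.2 hi
  · exact MeasurableSpace.measurableSet_iInf.2 fun i =>
      ((show IsOpen s from hs).preimage continuous_sigmaMk).measurableSet

/-- The coefficients of a polynomial orbit in the binomial basis. -/
noncomputable def binomialCoeff (d : ℕ) (y : Fin (d + 1) → UnitAddCircle) (i : ℕ) :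
    UnitAddCircle :=
  if h : i ≤ d then y ⟨d - i, by omega⟩ else 0

lemma binomialCoeff_of_lt {d i : ℕ} (y : Fin (d + 1) → UnitAddCircle) (h : d < i) :
    binomialCoeff d y i = 0 := dif_neg (by omega)

lemma binomialCoeff_sub {d : ℕ} (y : Fin (d + 1) → UnitAddCircle) (j : Fin (d + 1)) :
    binomialCoeff d y (d - j) = y j := by
  rw [binomialCoeff, dif_pos (Nat.sub_le _ _)]
  congr 1
  ext
  simp only
  omega

/-- Summing up to `n` instead of `d` is harmless, as the extra terms vanish either way. The form is
triangular with unit diagonal, so the values at `0, 1, …` determine the coefficients one after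
another, whatever the level. -/
lemma polynomialOrbit_natCast (d : ℕ) (y : Fin (d + 1) → UnitAddCircle) (n : ℕ) :
    polynomialOrbit d y n = ∑ i ∈ Finset.range (n + 1), n.choose i • binomialCoeff d y i := by
  have h1 : polynomialOrbit d y n =
      ∑ i ∈ Finset.range (d + 1), n.choose i • binomialCoeff d y i := by
    rw [← Finset.sum_range_reflect, Finset.sum_range, polynomialOrbit]
    refine Finset.sum_congr rfl fun j _ => ?_
    rw [Ring.choose_natCast, natCast_zsmul, add_tsub_cancel_right, binomialCoeff_sub]
  have h2 : ∀ k, (∀ i, k < i → n.choose i • binomialCoeff d y i = 0) → k ≤ d + n →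
      ∑ i ∈ Finset.range (k + 1), n.choose i • binomialCoeff d y i =
        ∑ i ∈ Finset.range (d + n + 1), n.choose i • binomialCoeff d y i := by
    intro k hk hkd
    refine Finset.sum_subset (Finset.range_mono (by omega)) fun i _ hi => hk i ?_
    rw [Finset.mem_range] at hi
    omega
  rw [h1, h2 d (fun i hi => by rw [binomialCoeff_of_lt y hi, smul_zero]) (by omega),
    h2 n (fun i hi => by rw [Nat.choose_eq_zero_of_lt hi, zero_smul]) (by omega)]

lemma binomialCoeff_eq_of_polynomialOrbit_eq {d d' : ℕ} {y : Fin (d + 1) → UnitAddCircle}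
    {y' : Fin (d' + 1) → UnitAddCircle}
    (h : ∀ n, polynomialOrbit d y n = polynomialOrbit d' y' n) (i : ℕ) :
    binomialCoeff d y i = binomialCoeff d' y' i := by
  induction i using Nat.strong_induction_on with
  | _ i ih =>
    have h1 := h i
    rw [polynomialOrbit_natCast, polynomialOrbit_natCast, Finset.sum_range_succ,
      Finset.sum_range_succ, Finset.sum_congr rfl fun j hj => by rw [ih j (Finset.mem_range.1 hj)],
      Nat.choose_self, one_smul, one_smul] at h1
    exact add_left_cancel h1

/-- The points of the mixture of exact level. -/
def exactPoints (c : ℝ) : Set (MixtureSpace c) := {z | z.2 0 ≠ 0}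

lemma measurableSet_exactPoints (c : ℝ) : MeasurableSet (exactPoints c) :=
  MeasurableSpace.measurableSet_iInf.2 fun d =>
    show MeasurableSet {y : Fin (d.1 + 1) → UnitAddCircle | y 0 ≠ 0} from
      measurable_pi_apply 0 (measurableSet_singleton 0).compl

/-- A nonzero leading coefficient `y 0` makes the level readable from the sequence. Without that
condition a point of level `d` with `y 0 = 0` could generate the same sequence as a point of lower
level. -/
lemma injOn_mixturePoint (c : ℝ) : Set.InjOn (mixturePoint c) (exactPoints c) := by
  rintro ⟨⟨d, hd⟩, y⟩ hy ⟨⟨d', hd'⟩, y'⟩ hy' h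
  change y 0 ≠ 0 at hy
  change y' 0 ≠ 0 at hy'
  have h1 : ∀ n, polynomialOrbit d y n = polynomialOrbit d' y' n := fun n =>
    AddCircle.injective_toCircle one_ne_zero 
      (Circle.ext (congrArg (fun x : ClosedDisc => (x : ℂ)) (congrFun h n)))
  have h2 := binomialCoeff_eq_of_polynomialOrbit_eq h1
  have hdd : d = d' := by
    have e1 := binomialCoeff_sub y 0
    have e2 := binomialCoeff_sub y' 0
    simp only [Fin.val_zero, Nat.sub_zero] at e1 e2
    rcases lt_trichotomy d d' with hlt | heq | hlt
    · rw [← h2, binomialCoeff_of_lt y hlt] at e2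
      exact absurd e2.symm hy'
    · exact heq
    · rw [h2, binomialCoeff_of_lt y' hlt] at e1
      exact absurd e1.symm hy
  subst hdd
  have hyy : y = y' := funext fun j => by rw [← binomialCoeff_sub y, ← binomialCoeff_sub y', h2]
  rw [hyy]

lemma exists_unipotentMap_eq (d : ℕ) (y : Fin (d + 1) → UnitAddCircle) :
    ∃ x, unipotentMap d x = y := by
  refine ⟨Fin.induction (y 0) fun j p => y j.succ - p, funext fun j => ?_⟩
  refine Fin.cases ?_ (fun j => ?_) j
  · simp [unipotentMap]
  · simp [unipotentMap]

lemma shift_injective : Function.Injective shift := fun x y h => funext fun n => by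
  have := congrFun h (n - 1)
  simpa [shift, shiftPow] using this

/-- The unipotent maps are surjective and fix the coordinate `0`, while the shift is injective; this
gives exact, not only almost everywhere, invariance. -/
lemma preimage_shift_image_exactPoints (c : ℝ) :
    shift ⁻¹' (mixturePoint c '' exactPoints c) = mixturePoint c '' exactPoints c := by
  ext x
  constructor
  · rintro ⟨⟨d, y⟩, hy, h⟩
    obtain ⟨y', rfl⟩ := exists_unipotentMap_eq d.1 y
    refine ⟨⟨d, y'⟩, hy, shift_injective ?_⟩
    rw [← h, ← mixturePoint_mixtureMap]
    rfl
  · rintro ⟨z, hz, rfl⟩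
    exact ⟨mixtureMap c z, hz, mixturePoint_mixtureMap c z⟩

lemma volume_singleton_unitAddCircle (x : UnitAddCircle) : volume ({x} : Set UnitAddCircle) = 0 := by
  rw [← Metric.closedBall_zero, AddCircle.volume_closedBall]
  simp

lemma mixtureMeasure_compl_exactPoints (c : ℝ) : mixtureMeasure c (exactPoints c)ᶜ = 0 := by
  have hm := (measurableSet_exactPoints c).compl
  have hlev : ∀ d, levelMeasure c d (exactPoints c)ᶜ = 0 := by
    intro d
    rw [levelMeasure, Measure.map_apply (measurable_level c d) hm]
    have h1 : (fun y : Fin (d.1 + 1) → UnitAddCircle => (⟨d, y⟩ : MixtureSpace c)) ⁻¹'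
        (exactPoints c)ᶜ = Function.eval 0 ⁻¹' {0} := by
      ext y
      simp [exactPoints]
    rw [h1, volume_pi, (measurePreserving_eval (fun _ => volume) 0).measure_preimage
      (measurableSet_singleton _).nullMeasurableSet, volume_singleton_unitAddCircle]
  rw [mixtureMeasure, Measure.add_apply, Measure.smul_apply, Measure.smul_apply, hlev,
    Measure.sum_apply _ hm]
  simp [hlev]

/-- By Lusin–Souslin the restriction of `mixturePoint` to the exact points is a measurable
embedding. Its inverse, extended measurably to the whole sequence space, is the isomorphism, with
the image of the exact points as invariant set of full measure. -/
theorem systemsIsomorphic_map_mixturePoint {c : ℝ} (hc : 0 < c) :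
    SystemsIsomorphic ((mixtureMeasure c).map (mixturePoint c)) shift (mixtureMeasure c)
      (mixtureMap c) := by
  have := Fact.mk hc
  have hmΨ := measurable_mixturePoint c
  have hae : ∀ᵐ z ∂mixtureMeasure c, z ∈ exactPoints c := mixtureMeasure_compl_exactPoints c
  have hborel : BorelSpace (MixtureSpace c) := inferInstance
  have hstd : StandardBorelSpace (MixtureSpace c) := inferInstance
  have hstd' : StandardBorelSpace (exactPoints c) := (measurableSet_exactPoints c).standardBorel
  have hne : Nonempty (exactPoints c) := let ⟨z, hz⟩ := hae.exists; ⟨⟨z, hz⟩⟩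
  have hemb : MeasurableEmbedding fun z : exactPoints c => mixturePoint c z :=
    (hmΨ.comp measurable_subtype_coe).measurableEmbedding (injOn_mixturePoint c).injective
  have hinv : ∀ z ∈ exactPoints c, ((hemb.invFun (mixturePoint c z) : exactPoints c) :
      MixtureSpace c) = z := fun z hz =>
    congrArg Subtype.val (hemb.leftInverse_invFun ⟨z, hz⟩)
  have hmΦ : Measurable fun x => ((hemb.invFun x : exactPoints c) : MixtureSpace c) :=
    measurable_subtype_coe.comp hemb.measurable_invFun
  have hA : MeasurableSet (mixturePoint c '' exactPoints c) :=
    (measurableSet_exactPoints c).image_of_measurable_injOn hmΨ (injOn_mixturePoint c)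
  have hA0 : (mixtureMeasure c).map (mixturePoint c) (mixturePoint c '' exactPoints c)ᶜ = 0 := by
    rw [Measure.map_apply hmΨ hA.compl]
    refine measure_mono_null (fun z hz hz' => hz ⟨z, hz', rfl⟩) (mixtureMeasure_compl_exactPoints c)
  refine ⟨fun x => (hemb.invFun x : exactPoints c), hmΦ, ?_, ?_, mixturePoint c '' exactPoints c,
    hA, preimage_shift_image_exactPoints c, hA0, ?_⟩
  · rw [Measure.map_map hmΦ hmΨ]
    conv_rhs => rw [← Measure.map_id (μ := mixtureMeasure c)]
    exact Measure.map_congr (hae.mono hinv)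
  · have : ∀ᵐ x ∂(mixtureMeasure c).map (mixturePoint c), x ∈ mixturePoint c '' exactPoints c := hA0
    filter_upwards [this]
    rintro _ ⟨z, hz, rfl⟩
    rw [← mixturePoint_mixtureMap, hinv z hz, hinv (mixtureMap c z) hz]
  · rintro _ ⟨z, hz, rfl⟩ _ ⟨z', hz', rfl⟩ h
    simp only [hinv z hz, hinv z' hz'] at h
    rw [h]

/-! ### Identification of the limit measure with the image of the mixture -/

theorem theorem2p21 (f : ℕ+ →* Circle) (t s : ℕ → ℕ) (hf : IsMRTFunction f t s)
    (a : SeqSpace) (ha : ∀ n : ℕ+, (a ((n : ℕ) : ℤ) : ℂ) = (f n : ℂ))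
    (c : ℝ) (hc : 0 < c) (L : ℕ → ℝ) (hL : HasFractionalDegree L (1 / c))
    (ht : c < 1 / 2 → ∀ᶠ m in atTop, L (s (m + 1)) ≤ (t (m + 1) : ℝ)) :
    (∃! μ : Measure SeqSpace, IsLogFurstenbergMeasure a (fun m => L (s (m + 1))) μ) ∧
    ∀ μ : Measure SeqSpace, IsLogFurstenbergMeasure a (fun m => L (s (m + 1))) μ →
      MeasurePreserving shift μ μ ∧
      systemSpectrum μ shift = {0} ∧
      StronglyStationary μ ∧
      SystemsIsomorphic μ shift (mixtureMeasure c) (mixtureMap c) := by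
  have := Fact.mk hc
  have hmΨ := measurable_mixturePoint c
  have hprob : IsProbabilityMeasure ((mixtureMeasure c).map (mixturePoint c)) :=
    Measure.isProbabilityMeasure_map hmΨ.aemeasurable
  have hcorr : ∀ l, ∫ x, coordMonomial l x ∂(mixtureMeasure c).map (mixturePoint c) =
      ((SignedShifts.correlation c l : ℝ) : ℂ) := fun l => by
    rw [integral_map hmΨ.aemeasurable (coordMonomial l).continuous.aestronglyMeasurable,
      integral_coordMonomial_mixturePoint hc]
  have hlim := hf.tendsto_logAverage_coordMonomial ha hc hL ht
  have hex : IsLogFurstenbergMeasure a (fun m => L (s (m + 1)))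
      ((mixtureMeasure c).map (mixturePoint c)) :=
    ⟨hprob, tendsto_logAverage_of_coordMonomial fun l => by rw [hcorr]; exact hlim l⟩
  have huniq : ∀ μ : Measure SeqSpace, IsLogFurstenbergMeasure a (fun m => L (s (m + 1))) μ →
      μ = (mixtureMeasure c).map (mixturePoint c) := by
    intro μ hμ
    have := hμ.isProbabilityMeasure
    refine ext_of_integral_coordMonomial fun l => ?_
    rw [hcorr]
    exact tendsto_nhds_unique (hμ.tendsto_logAverage (coordMonomial l)) (hlim l)
  refine ⟨⟨_, hex, huniq⟩, fun μ hμ => ?_⟩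
  rw [huniq μ hμ]
  exact ⟨measurePreserving_shift hcorr, systemSpectrum_eq_zero hcorr,
    stronglyStationary_of_correlation hcorr, systemsIsomorphic_map_mixturePoint hc⟩
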